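/- **Setting.** Let $X$ be a countable set with at least two elements, $p$ an irreducible transition probability on $X$, $a:X\to(0,\infty)$, and let $\mathfrak X=\{\eta\in\mathbb N^X:\ \|\eta\|=\sum_x\eta(x)a_x<\infty\}$ with the distance $\|\eta-\zeta\|=\sum_x|\eta(x)-\zeta(x)|a_x$ and the coordinatewise order. Let $\pi:\mathbb N\to(0,\infty)$ and $h:\mathbb N\setminus\{0\}\to[0,\infty)$. The mass migration zero range process MM-ZRP$(\pi,h)$ is the Markov process on $\mathfrak X$ in which, for $1\le k\le\alpha$, $k$ of the $\alpha$ particles at $x$ jump together to $y$ at rate $p(x,y)\,g^k_\alpha$, where $$g^k_\alpha=\frac{\pi(\alpha-k)}{\pi(\alpha)}\,h(k)$$ (a jump from a site to itself changes nothing). Precisely, it is given by a Markov semigroup of kernels on $\mathfrak X$, with action $S(t)f$ on bounded measurable functions, such that for every bounded Lipschitz $f$ the function $S(t)f$ is continuous and, for every configuration $\eta$ with finitely many particles, $S(t)f(\eta)=f(\eta)+\int_0^t\mathcal L S(s)f(\eta)\,ds$, where $\mathcal L f(\eta)=\sum_{x,y}p(x,y)\sum_{k=1}^{\eta(x)}g^k_{\eta(x)}\big(f(\eta^{x,y,k})-f(\eta)\big)$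 and $\eta^{x,y,k}$ is $\eta$ after the jump. All statements below are about such a process, whenever it exists. It is called *attractive* if for every bounded, monotone (nondecreasing), continuous $f$ on $\mathfrak X$ and every $t>0$, $S(t)f$ is again bounded, monotone and continuous. Put $r(n)=\pi(n)/\pi(n+1)$ for $n\ge0$. **Condition for attractiveness.** MM-ZRP$(\pi,h)$ is attractive if and only if for all $\alpha\ge1$ and $1\le m\le\alpha$ $$0\ \le\ \sum_{j=0}^{m-1}\pi(j)\Big(\frac{h(\alpha-j)}{\pi(\alpha)}-\frac{h(\alpha+1-j)}{\pi(\alpha+1)}\Big)\ \le\ \frac{\pi(m)\,h(\alpha+1-m)}{\pi(\alpha+1)}.\tag{A}$$ **(a)** Assume that $r$ is nonincreasing on $\{1,2,\dots\}$. Then (A), and hence attractiveness of MM-ZRP$(\pi,h)$, is equivalent to the conjunction of $$\frac{h(\alpha+1)}{\pi(\alpha+1)}\le\frac{h(\alpha)}{\pi(\alpha)}\quad\forall\alpha\ge1,\tag{at-1}$$ $$\sum_{k=1}^{\alpha}h(k)\Big(\frac{\pi(\alpha-k)}{\pi(\alpha)}-\frac{\pi(\alpha-k+1)}{\pi(\alpha+1)}\Big)\le\pi(0)\,\frac{h(\alpha+1)}{\pi(\alpha+1)}\quad\forall\alpha\ge1.\tag{at-2}$$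 If $h$ is not identically zero, the following condition is necessary for attractiveness of MM-ZRP$(\pi,h)$: $$\frac1{\pi(\alpha)}\sum_{i=1}^{\alpha-1}\pi(i)\pi(\alpha-i)\ \le\ \frac1{\pi(\alpha+1)}\sum_{i=1}^{\alpha}\pi(i)\pi(\alpha+1-i)\quad\forall\alpha\ge2.\tag{at-3}$$ If moreover $h(k)=h_0\pi(k)$ for all $k\ge1$, with a constant $h_0>0$, then (at-3) is necessary and sufficient for attractiveness. Consequently, still for $r$ nonincreasing on $\{1,2,\dots\}$ (and with the same $X,p,a$): if MM-ZRP$(\pi,\pi)$ is not attractive, then MM-ZRP$(\pi,h)$ is not attractive for any $h$ that is not identically zero. Moreover, if $h=h_0\pi$ with $h_0>0$, MM-ZRP$(\pi,h)$ is attractive if and only if $F(\alpha)\ge0$ for all $\alpha\ge2$, where $F(2)=-\frac12+\frac{r(2)}{r(1)}$, $F(3)=-1+\frac{r(3)}{r(2)}+\frac12\frac{r(3)}{r(1)}$, for even $\alpha\ge4$ $$F(\alpha)=-1-\sum_{i=2}^{\alpha/2}\frac{r(\alpha-2)\cdots r(\alpha-i)}{r(1)\cdots r(i-1)}+\frac12\,\frac{r(\alpha-2)\cdots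 r(\frac\alpha2)}{r(1)\cdots r(\frac\alpha2-1)}+\frac{r(\alpha)}{r(\alpha-1)}\Big(1+\sum_{i=2}^{\alpha/2}\frac{r(\alpha-1)\cdots r(\alpha-i+1)}{r(1)\cdots r(i-1)}\Big),$$ and for odd $\alpha\ge5$ $$F(\alpha)=-1-\sum_{i=2}^{(\alpha-1)/2}\frac{r(\alpha-2)\cdots r(\alpha-i)}{r(1)\cdots r(i-1)}+\frac{r(\alpha)}{r(\alpha-1)}\Big(1+\sum_{i=2}^{(\alpha-1)/2}\frac{r(\alpha-1)\cdots r(\alpha-i+1)}{r(1)\cdots r(i-1)}+\frac12\,\frac{r(\alpha-1)\cdots r(\frac{\alpha+1}2)}{r(1)\cdots r(\frac{\alpha-1}2)}\Big).$$ **(b)** Assume that $r$ is nondecreasing on $\{1,2,\dots\}$. Then (at-1) is necessary for attractiveness of MM-ZRP$(\pi,h)$. If in addition $r(0)\le r(1)$, the condition $$\frac{\pi(\alpha+1)}{\pi(\alpha)}\ \ge\ \max_{1\le k\le\alpha}\frac{h(k+1)}{h(k)}\quad\forall\alpha\ge1$$ is sufficient for attractiveness; where $h(k)=0$ this inequality is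 read as $h(k+1)\le\frac{\pi(\alpha+1)}{\pi(\alpha)}h(k)$. -/

import Mathlib

open MeasureTheory ProbabilityTheory Finset
open scoped NNReal

noncomputable section

namespace MassMigration

/-! ### Configurations -/

/-- The state space: configurations `η : X → ℕ` with `‖η‖ = ∑ₓ η(x) aₓ < ∞`. -/
def Config {X : Type*} (a : X → ℝ≥0) : Type _ :=
  {η : X → ℕ // Summable fun x => (η x : ℝ) * (a x : ℝ)}

instance {X : Type*} (a : X → ℝ≥0) : CoeFun (Config a) (fun _ => X → ℕ) := ⟨Subtype.val⟩

/-- The coordinatewise partial order. -/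
instance {X : Type*} (a : X → ℝ≥0) : PartialOrder (Config a) :=
  PartialOrder.lift (Subtype.val : Config a → X → ℕ) Subtype.val_injective

theorem Config.summable_dist {X : Type*} {a : X → ℝ≥0} (η ζ : Config a) :
    Summable fun x => |(η x : ℝ) - (ζ x : ℝ)| * (a x : ℝ) := by
  refine Summable.of_nonneg_of_le (fun x => by positivity) (fun x => ?_) (η.2.add ζ.2)
  rw [← add_mul]
  refine mul_le_mul_of_nonneg_right ?_ (a x).2
  have h1 : (0 : ℝ) ≤ (η x : ℝ) := Nat.cast_nonneg _
  have h2 : (0 : ℝ) ≤ (ζ x : ℝ) := Nat.cast_nonneg _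
  have := abs_sub (η x : ℝ) (ζ x : ℝ)
  rwa [abs_of_nonneg h1, abs_of_nonneg h2] at this

/-- The distance `‖η - ζ‖ = ∑ₓ |η(x) - ζ(x)| aₓ` (a metric as soon as all weights are positive). -/
instance {X : Type*} (a : X → ℝ≥0) : PseudoMetricSpace (Config a) where
  dist η ζ := ∑' x, |(η x : ℝ) - (ζ x : ℝ)| * (a x : ℝ)
  dist_self η := by simp
  dist_comm η ζ := by simp only [abs_sub_comm]
  dist_triangle η ζ ξ := by
    rw [← (η.summable_dist ζ).tsum_add (ζ.summable_dist ξ)]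
    refine (η.summable_dist ξ).tsum_le_tsum (fun x => ?_)
      ((η.summable_dist ζ).add (ζ.summable_dist ξ))
    rw [← add_mul]
    exact mul_le_mul_of_nonneg_right (abs_sub_le _ _ _) (a x).2

instance {X : Type*} (a : X → ℝ≥0) : MeasurableSpace (Config a) := borel _

instance {X : Type*} (a : X → ℝ≥0) : BorelSpace (Config a) := ⟨rfl⟩

open Classical in
/-- `k` particles are moved from `x` to `y`; nothing happens when fewer than `k` particles are
present at `x`, or when the target is the departure site itself. -/
def moveFun {X : Type*} (η : X → ℕ) (x y : X) (k : ℕ) : X → ℕ := fun z =>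
  if x = y ∨ η x < k then η z
  else if z = x then η x - k
  else if z = y then η y + k
  else η z

/-- The configuration after the jump of `k` particles from `x` to `y`. -/
def Config.move {X : Type*} {a : X → ℝ≥0} (η : Config a) (x y : X) (k : ℕ) : Config a :=
  ⟨moveFun η x y k, by
    classical
    refine (summable_congr_cofinite ?_).2 η.2
    have hfin : ({x, y} : Set X).Finite := by simp
    filter_upwards [hfin.compl_mem_cofinite] with z hz
    simp only [Set.mem_compl_iff, Set.mem_insert_iff, Set.mem_singleton_iff, not_or] at hz
    simp [moveFun, hz.1, hz.2]⟩

/-! ### Mass migration processes -/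

/-- `p` is a transition probability on `X`. -/
def IsTransition {X : Type*} (p : X → X → ℝ) : Prop :=
  (∀ x y, 0 ≤ p x y) ∧ ∀ x, HasSum (p x) 1

/-- Any site can be reached from any site through steps of positive probability. -/
def IsIrreducibleTransition {X : Type*} (p : X → X → ℝ) : Prop :=
  ∀ x y, Relation.ReflTransGen (fun u v => 0 < p u v) x y

/-- The generator of the mass migration dynamics: `k` particles jump from `x` to `y` at rate
`p(x,y) g^k_{η(x),η(y)}`, where `g α β k` stands for `g^k_{α,β}`. -/
def generator {X : Type*} {a : X → ℝ≥0} (p : X → X → ℝ) (g : ℕ → ℕ → ℕ → ℝ)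
    (f : Config a → ℝ) (η : Config a) : ℝ :=
  ∑' x, ∑' y, p x y *
    ∑ k ∈ Finset.Icc 1 (η x), g (η x) (η y) k * (f (η.move x y k) - f η)

/-- The action on functions, `S(t) f (η) = ∫ f(ξ) P_t(η, dξ)`, of a family of transition
kernels. -/
def semigroup {X : Type*} {a : X → ℝ≥0} (P : ℝ≥0 → Kernel (Config a) (Config a)) (t : ℝ≥0)
    (f : Config a → ℝ) (η : Config a) : ℝ :=
  ∫ ξ, f ξ ∂(P t η)

/-- `f` is bounded. -/
def IsBdd {E : Type*} (f : E → ℝ) : Prop := ∃ C : ℝ, ∀ e, |f e| ≤ C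

/-- `P` is the family of transition kernels of the mass migration process with jump kernel `p` and
rates `g`: a Markov semigroup which sends bounded Lipschitz functions to continuous functions
and which, started from a configuration with finitely many particles, satisfies
`S(t) f (η) = f(η) + ∫₀ᵗ 𝓛 S(s) f (η) ds` for bounded Lipschitz `f`.
For a configuration with finitely many particles the total jump rate is bounded along the whole
evolution, so `𝓛 u (η)` is an absolutely convergent sum for every bounded `u`, and the equation
says that the process is the (nonexplosive) Markov chain with the given rates. As the
configurations with finitely many particles are dense, `P` is determined by these properties.
A Markov semigroup which preserves the Lipschitz functions and satisfies the equation at all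
configurations has these properties, and so has the process on a finite set of sites,
whatever the rates. -/
structure IsMassMigrationProcess {X : Type*} {a : X → ℝ≥0} (p : X → X → ℝ)
    (g : ℕ → ℕ → ℕ → ℝ) (P : ℝ≥0 → Kernel (Config a) (Config a)) : Prop where
  markov : ∀ t, IsMarkovKernel (P t)
  zero : P 0 = Kernel.id
  add : ∀ s t, P (s + t) = P t ∘ₖ P s
  continuous_of_lipschitz : ∀ (t : ℝ≥0) (f : Config a → ℝ), IsBdd f →
    (∃ K : ℝ≥0, LipschitzWith K f) → Continuous (semigroup P t f)
  kolmogorov : ∀ f : Config a → ℝ, IsBdd f → (∃ K : ℝ≥0, LipschitzWith K f) →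
    ∀ η : Config a, (Function.support (η : X → ℕ)).Finite → ∀ t : ℝ≥0,
      IntervalIntegrable (fun s : ℝ => generator p g (semigroup P s.toNNReal f) η) volume 0 t ∧
      semigroup P t f η =
        f η + ∫ s in (0 : ℝ)..t, generator p g (semigroup P s.toNNReal f) η

/-- Attractiveness: the semigroup preserves the bounded, monotone, continuous functions. -/
def Attractive {X : Type*} {a : X → ℝ≥0} (P : ℝ≥0 → Kernel (Config a) (Config a)) : Prop :=
  ∀ f : Config a → ℝ, IsBdd f → Monotone f → Continuous f → ∀ t : ℝ≥0, 0 < t →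
    IsBdd (semigroup P t f) ∧ Monotone (semigroup P t f) ∧ Continuous (semigroup P t f)

/-! ### Zero range rates of product form -/

/-- The rates `g^k_α = π(α-k) h(k) / π(α)` for `1 ≤ k ≤ α`, and `0` otherwise. -/
def zrpRate (π h : ℕ → ℝ) (α _β k : ℕ) : ℝ :=
  if 1 ≤ k ∧ k ≤ α then π (α - k) / π α * h k else 0

/-- `P` is the mass migration zero range process with rates `π(α-k) h(k) / π(α)`. -/
def IsMMZRP {X : Type*} {a : X → ℝ≥0} (p : X → X → ℝ) (π h : ℕ → ℝ)
    (P : ℝ≥0 → Kernel (Config a) (Config a)) : Prop :=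
  IsMassMigrationProcess p (zrpRate π h) P

/-- `r(n) = π(n) / π(n+1)`. -/
def ratio (π : ℕ → ℝ) (n : ℕ) : ℝ := π n / π (n + 1)

/-- For all `α ≥ 1` and `1 ≤ m ≤ α`,
`0 ≤ ∑_{j<m} π(j) (h(α-j)/π(α) - h(α+1-j)/π(α+1)) ≤ π(m) h(α+1-m) / π(α+1)`. -/
def AttractCond (π h : ℕ → ℝ) : Prop :=
  ∀ α m : ℕ, 1 ≤ m → m ≤ α →
    0 ≤ ∑ j ∈ Finset.range m, π j * (h (α - j) / π α - h (α + 1 - j) / π (α + 1)) ∧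
    ∑ j ∈ Finset.range m, π j * (h (α - j) / π α - h (α + 1 - j) / π (α + 1)) ≤
      π m * h (α + 1 - m) / π (α + 1)

/-- `h(α+1)/π(α+1) ≤ h(α)/π(α)` for all `α ≥ 1`. -/
def AtOne (π h : ℕ → ℝ) : Prop :=
  ∀ α : ℕ, 1 ≤ α → h (α + 1) / π (α + 1) ≤ h α / π α

/-- `∑_{k=1}^α h(k) (π(α-k)/π(α) - π(α-k+1)/π(α+1)) ≤ π(0) h(α+1)/π(α+1)` for all `α ≥ 1`. -/
def AtTwo (π h : ℕ → ℝ) : Prop :=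
  ∀ α : ℕ, 1 ≤ α →
    ∑ k ∈ Finset.Icc 1 α, h k * (π (α - k) / π α - π (α - k + 1) / π (α + 1)) ≤
      π 0 * (h (α + 1) / π (α + 1))

/-- `(1/π(α)) ∑_{i=1}^{α-1} π(i) π(α-i) ≤ (1/π(α+1)) ∑_{i=1}^{α} π(i) π(α+1-i)` for all
`α ≥ 2`. -/
def AtThree (π : ℕ → ℝ) : Prop :=
  ∀ α : ℕ, 2 ≤ α →
    1 / π α * ∑ i ∈ Finset.Icc 1 (α - 1), π i * π (α - i) ≤
      1 / π (α + 1) * ∑ i ∈ Finset.Icc 1 α, π i * π (α + 1 - i)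

/-- `π(α+1)/π(α) ≥ h(k+1)/h(k)` for all `1 ≤ k ≤ α`, the denominator `h(k) ≥ 0` being cleared
(so a zero of `h` at `k` forces a zero at `k+1`). -/
def AtBis (π h : ℕ → ℝ) : Prop :=
  ∀ α k : ℕ, 1 ≤ k → k ≤ α → h (k + 1) ≤ π (α + 1) / π α * h k

/-- The function `F(α)`, for `α ≥ 2`, of the sequence `r`. Here `α / 2` is the integer part, which
is `(α-1)/2` for odd `α`; products are written with increasing indices. -/
def critF (r : ℕ → ℝ) (α : ℕ) : ℝ :=
  if α = 2 then -1 / 2 + r 2 / r 1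
  else if α = 3 then -1 + r 3 / r 2 + 1 / 2 * (r 3 / r 1)
  else if Even α then
    -1 - ∑ i ∈ Finset.Icc 2 (α / 2),
        (∏ j ∈ Finset.Icc (α - i) (α - 2), r j) / ∏ j ∈ Finset.Icc 1 (i - 1), r j
      + 1 / 2 * ((∏ j ∈ Finset.Icc (α / 2) (α - 2), r j) / ∏ j ∈ Finset.Icc 1 (α / 2 - 1), r j)
      + r α / r (α - 1) *
        (1 + ∑ i ∈ Finset.Icc 2 (α / 2),
          (∏ j ∈ Finset.Icc (α - i + 1) (α - 1), r j) / ∏ j ∈ Finset.Icc 1 (i - 1), r j)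
  else
    -1 - ∑ i ∈ Finset.Icc 2 (α / 2),
        (∏ j ∈ Finset.Icc (α - i) (α - 2), r j) / ∏ j ∈ Finset.Icc 1 (i - 1), r j
      + r α / r (α - 1) *
        (1 + ∑ i ∈ Finset.Icc 2 (α / 2),
          (∏ j ∈ Finset.Icc (α - i + 1) (α - 1), r j) / ∏ j ∈ Finset.Icc 1 (i - 1), r j
        + 1 / 2 * ((∏ j ∈ Finset.Icc ((α + 1) / 2) (α - 1), r j) /
            ∏ j ∈ Finset.Icc 1 ((α - 1) / 2), r j))

end MassMigration

end

/-! Attractiveness is a statement about tails of jump rates; the rest is algebra with `π`, `r` and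
`h`.

Write c(α,l) for the rate at which l of α particles leave a site. Condition (A) says that ∑_{l>k}
c(α+1,l) ≤ ∑_{l≥k} c(α,l) ≤ ∑_{l≥k} c(α+1,l) for 1 ≤ k ≤ α (`attractCond_iff_tailCond`). This is
what is needed to couple two configurations that differ by one particle so that they stay ordered
and differ by one particle: the larger pile sends as many particles as the smaller one, or one more.
Hence the differences S(t)f(η+δ_z) - S(t)f(η), for monotone f, obey a Markovian evolution
inequality. Its rates are bounded because jumps conserve the number of particles, and a minimum
principle (`nonneg_of_integral_eq`) keeps the differences nonnegative. Approximation by local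
functions and finite configurations, together with the Feller property, gives monotonicity on the
whole space. Conversely, if η ≤ ζ and f(η) = f(ζ), attractiveness forces 𝓛f(η) ≤ 𝓛f(ζ)
(`Attractive.finGen_le`). Indicators of η(x) ≥ n at the departure and the arrival site, tested on
single piles of α and α+1 particles, give the two tail inequalities.

For the algebra, an index shift (`sum_diff_le_iff`) turns the upper bound in (A) into a sum whose
terms have the sign of r(j) - r(α). When r is nonincreasing, the bound for m = α is the strongest,
and (at-1) gives the lower bound term by term. With φ = h/π, (at-2) is a weighted form of (at-3),
the weights φ being nonincreasing by (at-1); comparing with φ(α) gives (at-3), and constant φ gives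
the equivalence. Finally F is, up to a positive factor, the difference of the two sides of (at-3),
folded by the reflection of the summation index. -/

noncomputable section

namespace MassMigration

/-! ### Algebra of the conditions (A), (at-1), (at-2), (at-3) -/

section Algebra

variable {π h : ℕ → ℝ}

/-- Moving the boundary term to the left extends the second sum to j = m. Its term j = 0 becomes the
new right side, and shifting the others by one pairs them with the same `h (α - j)`. -/
theorem sum_diff_le_iff (π h : ℕ → ℝ) (α m : ℕ) :
    ∑ j ∈ Finset.range m, π j * (h (α - j) / π α - h (α + 1 - j) / π (α + 1)) ≤
        π m * h (α + 1 - m) / π (α + 1) ↔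
      ∑ j ∈ Finset.range m, h (α - j) * (π j / π α - π (j + 1) / π (α + 1)) ≤
        π 0 * (h (α + 1) / π (α + 1)) := by
  have h1 : ∑ j ∈ Finset.range m, π j * (h (α - j) / π α - h (α + 1 - j) / π (α + 1)) =
      ∑ j ∈ Finset.range m, π j * h (α - j) / π α -
        ∑ j ∈ Finset.range m, π j * h (α + 1 - j) / π (α + 1) := by
    rw [← Finset.sum_sub_distrib]
    exact Finset.sum_congr rfl fun j _ => by ring
  have h2 : ∑ j ∈ Finset.range m, h (α - j) * (π j / π α - π (j + 1) / π (α + 1)) =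
      ∑ j ∈ Finset.range m, π j * h (α - j) / π α -
        ∑ j ∈ Finset.range m, π (j + 1) * h (α + 1 - (j + 1)) / π (α + 1) := by
    rw [← Finset.sum_sub_distrib]
    exact Finset.sum_congr rfl fun j _ => by rw [Nat.add_sub_add_right]; ring
  have h3 := Finset.sum_range_succ (fun j => π j * h (α + 1 - j) / π (α + 1)) m
  rw [Finset.sum_range_succ'] at h3
  rw [h1, h2]
  simp only [Nat.sub_zero, mul_div_assoc] at h3 ⊢
  constructor <;> intro h4 <;> linarith

theorem sum_range_eq_sum_Icc (π h : ℕ → ℝ) (α : ℕ) :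
    ∑ j ∈ Finset.range α, h (α - j) * (π j / π α - π (j + 1) / π (α + 1)) =
      ∑ k ∈ Finset.Icc 1 α, h k * (π (α - k) / π α - π (α - k + 1) / π (α + 1)) := by
  refine Finset.sum_nbij' (fun j => α - j) (fun k => α - k) ?_ ?_ ?_ ?_ ?_
  · intro j hj; simp only [Finset.mem_range, Finset.mem_Icc] at *; omega
  · intro j hj; simp only [Finset.mem_range, Finset.mem_Icc] at *; omega
  · intro j hj; simp only [Finset.mem_range] at *; omega
  · intro j hj; simp only [Finset.mem_Icc] at *; omega
  · intro j hj
    simp only [Finset.mem_range] at hj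
    rw [Nat.sub_sub_self hj.le]

theorem atTwo_iff (π h : ℕ → ℝ) :
    AtTwo π h ↔ ∀ α, 1 ≤ α →
      ∑ j ∈ Finset.range α, h (α - j) * (π j / π α - π (j + 1) / π (α + 1)) ≤
        π 0 * (h (α + 1) / π (α + 1)) := by
  simp only [AtTwo, sum_range_eq_sum_Icc]

/-- This is the lower bound for m = 1. Monotonicity of r plays no role, so it also serves part (b).
-/
theorem AttractCond.atOne (hπ : ∀ n, 0 < π n) (H : AttractCond π h) : AtOne π h := by
  intro α hα
  have := (H α 1 le_rfl hα).1
  simp only [Finset.sum_range_one, Nat.sub_zero] at this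
  linarith [nonneg_of_mul_nonneg_right this (hπ 0)]

theorem AttractCond.atTwo (H : AttractCond π h) : AtTwo π h :=
  (atTwo_iff π h).2 fun α hα => (sum_diff_le_iff π h α α).1 (H α α hα le_rfl).2

theorem ratio_pos (hπ : ∀ n, 0 < π n) (n : ℕ) : 0 < ratio π n := div_pos (hπ _) (hπ _)

/-- Source of every sign in this part: monotonicity of r decides the sign of the coefficient. -/
theorem div_sub_div_eq_ratio (hπ : ∀ n, 0 < π n) (j α : ℕ) :
    π j / π α - π (j + 1) / π (α + 1) = π (j + 1) / π α * (ratio π j - ratio π α) := by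
  have h1 := (hπ j).ne'
  have h2 := (hπ (j + 1)).ne'
  have h3 := (hπ α).ne'
  have h4 := (hπ (α + 1)).ne'
  unfold ratio
  field_simp

theorem div_sub_div_nonneg (hπ : ∀ n, 0 < π n) (hr : AntitoneOn (ratio π) (Set.Ici 1))
    {j α : ℕ} (hj : 1 ≤ j) (hjα : j ≤ α) : 0 ≤ π j / π α - π (j + 1) / π (α + 1) := by
  rw [div_sub_div_eq_ratio hπ]
  exact mul_nonneg (div_pos (hπ _) (hπ _)).le
    (sub_nonneg.2 (hr hj (show 1 ≤ α from hj.trans hjα) hjα))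

/-- For the converse, each term of the lower bound is nonnegative: it is (at-1) multiplied by a
second inequality that comes from r. In the shifted upper bound, enlarging m to α only adds terms
with j ≥ 1, which are nonnegative, so (at-2) suffices. -/
theorem attractCond_iff_of_antitoneOn (hπ : ∀ n, 0 < π n) (hh : ∀ k, 1 ≤ k → 0 ≤ h k)
    (hr : AntitoneOn (ratio π) (Set.Ici 1)) :
    AttractCond π h ↔ AtOne π h ∧ AtTwo π h := by
  refine ⟨fun H => ⟨H.atOne hπ, H.atTwo⟩, fun ⟨H1, H2⟩ α m hm hmα => ⟨?_, ?_⟩⟩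
  · refine Finset.sum_nonneg fun j hj => mul_nonneg (hπ j).le ?_
    rw [Finset.mem_range] at hj
    obtain ⟨k, rfl⟩ : ∃ k, α = k + j := ⟨α - j, by omega⟩
    have hk : 1 ≤ k := by omega
    rw [show k + j + 1 - j = k + 1 by omega, Nat.add_sub_cancel]
    have h1 := H1 k hk
    have h2 := div_sub_div_nonneg hπ hr hk (Nat.le_add_right k j)
    have h3 : h (k + 1) / π (k + j + 1) = h (k + 1) / π (k + 1) * (π (k + 1) / π (k + j + 1)) := by
      have := (hπ (k + 1)).ne'
      field_simp
    have h4 : h k / π (k + j) = h k / π k * (π k / π (k + j)) := by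
      have := (hπ k).ne'
      field_simp
    rw [h3, h4, sub_nonneg]
    exact mul_le_mul h1 (by linarith) (div_pos (hπ _) (hπ _)).le
      (div_nonneg (hh k hk) (hπ k).le)
  · rw [sum_diff_le_iff]
    refine le_trans ?_ ((atTwo_iff π h).1 H2 α (hm.trans hmα))
    refine Finset.sum_le_sum_of_subset_of_nonneg (Finset.range_mono hmα) fun j hj hj' => ?_
    rw [Finset.mem_range] at hj hj'
    exact mul_nonneg (hh _ (by omega)) (div_sub_div_nonneg hπ hr (by omega) (by omega))

/-- Both bounds hold term by term. After the shift, the left side of the upper bound is a sum of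
nonpositive terms; the term j = 0 is the only one to involve r(0), whence `hr0`. -/
theorem AtBis.attractCond (hπ : ∀ n, 0 < π n) (hh : ∀ k, 1 ≤ k → 0 ≤ h k)
    (hr : MonotoneOn (ratio π) (Set.Ici 1)) (hr0 : ratio π 0 ≤ ratio π 1) (H : AtBis π h) :
    AttractCond π h := by
  refine fun α m hm hmα => ⟨?_, ?_⟩
  · refine Finset.sum_nonneg fun j hj => mul_nonneg (hπ j).le ?_
    rw [Finset.mem_range] at hj
    have h1 := H α (α - j) (by omega) (by omega)
    rw [show α + 1 - j = α - j + 1 by omega, sub_nonneg, div_le_iff₀ (hπ _)]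
    exact h1.trans_eq (by ring)
  · rw [sum_diff_le_iff]
    refine (Finset.sum_nonpos fun j hj => ?_).trans
      (mul_nonneg (hπ 0).le (div_nonneg (hh _ (by omega)) (hπ _).le))
    rw [Finset.mem_range] at hj
    refine mul_nonpos_of_nonneg_of_nonpos (hh _ (by omega)) ?_
    rw [div_sub_div_eq_ratio hπ]
    refine mul_nonpos_of_nonneg_of_nonpos (div_pos (hπ _) (hπ _)).le (sub_nonpos.2 ?_)
    have hα : 1 ≤ α := hm.trans hmα
    rcases Nat.eq_zero_or_pos j with rfl | hj0
    · exact hr0.trans (hr (show 1 ≤ 1 from le_rfl) hα hα)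
    · exact hr hj0 hα (by omega)

/-- The excess `π(k) (π(α-k)/π(α) - π(α+1-k)/π(α+1))`. -/
def excess (π : ℕ → ℝ) (α k : ℕ) : ℝ := π k * (π (α - k) / π α - π (α + 1 - k) / π (α + 1))

theorem excess_nonneg (hπ : ∀ n, 0 < π n) (hr : AntitoneOn (ratio π) (Set.Ici 1))
    {α k : ℕ} (hkα : k < α) : 0 ≤ excess π α k := by
  unfold excess
  rw [show α + 1 - k = α - k + 1 by omega]
  exact mul_nonneg (hπ k).le (div_sub_div_nonneg hπ hr (by omega) (by omega))

theorem atThree_ineq_iff (π : ℕ → ℝ) {α : ℕ} (hα : 1 ≤ α) :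
    1 / π α * ∑ i ∈ Finset.Icc 1 (α - 1), π i * π (α - i) ≤
        1 / π (α + 1) * ∑ i ∈ Finset.Icc 1 α, π i * π (α + 1 - i) ↔
      ∑ k ∈ Finset.Icc 1 (α - 1), excess π α k ≤ ratio π α * π 1 := by
  obtain ⟨n, rfl⟩ : ∃ n, α = n + 1 := ⟨α - 1, by omega⟩
  have h1 : ∑ k ∈ Finset.Icc 1 n, excess π (n + 1) k =
      1 / π (n + 1) * ∑ i ∈ Finset.Icc 1 n, π i * π (n + 1 - i) -
        1 / π (n + 1 + 1) * ∑ i ∈ Finset.Icc 1 n, π i * π (n + 1 + 1 - i) := by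
    rw [Finset.mul_sum, Finset.mul_sum, ← Finset.sum_sub_distrib]
    exact Finset.sum_congr rfl fun i _ => by unfold excess; ring
  rw [Nat.add_sub_cancel, h1, Finset.sum_Icc_succ_top (by omega : 1 ≤ n + 1),
    show n + 1 + 1 - (n + 1) = 1 by omega, ratio, mul_add,
    show 1 / π (n + 1 + 1) * (π (n + 1) * π 1) = π (n + 1) / π (n + 1 + 1) * π 1 by ring]
  constructor <;> intro h2 <;> linarith

/-- Rewrites (at-2) with the weights φ = h/π. The term k = α is split off because it involves r(0),
on which monotonicity from 1 onwards says nothing. -/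
theorem atTwo_ineq_iff (hπ : ∀ n, 0 < π n) {α : ℕ} (hα : 1 ≤ α) :
    ∑ k ∈ Finset.Icc 1 α, h k * (π (α - k) / π α - π (α - k + 1) / π (α + 1)) ≤
        π 0 * (h (α + 1) / π (α + 1)) ↔
      ∑ k ∈ Finset.Icc 1 (α - 1), h k / π k * excess π α k +
        h α / π α * (π 0 - ratio π α * π 1) ≤ π 0 * (h (α + 1) / π (α + 1)) := by
  obtain ⟨n, rfl⟩ : ∃ n, α = n + 1 := ⟨α - 1, by omega⟩
  have h1 : ∑ k ∈ Finset.Icc 1 n, h k / π k * excess π (n + 1) k = ∑ k ∈ Finset.Icc 1 n,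
      h k * (π (n + 1 - k) / π (n + 1) - π (n + 1 - k + 1) / π (n + 1 + 1)) := by
    refine Finset.sum_congr rfl fun k hk => ?_
    rw [Finset.mem_Icc] at hk
    have := (hπ k).ne'
    rw [excess, show n + 1 + 1 - k = n + 1 - k + 1 by omega]
    field_simp
  rw [Nat.add_sub_cancel, h1, Finset.sum_Icc_succ_top (by omega : 1 ≤ n + 1), Nat.sub_self,
    Nat.zero_add, ratio]
  have h2 : h (n + 1) / π (n + 1) * (π 0 - π (n + 1) / π (n + 1 + 1) * π 1) =
      h (n + 1) * (π 0 / π (n + 1) - π 1 / π (n + 1 + 1)) := by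
    have := (hπ (n + 1)).ne'
    field_simp
  rw [h2]

theorem AtOne.antitone_div (H : AtOne π h) {j k : ℕ} (hj : 1 ≤ j) (hjk : j ≤ k) :
    h k / π k ≤ h j / π j := by
  induction k, hjk using Nat.le_induction with
  | base => exact le_rfl
  | succ k hk ih => exact (H k (hj.trans hk)).trans ih

theorem excess_eq_zero_iff (hπ : ∀ n, 0 < π n) {α k : ℕ} (hk : k ≤ α) :
    excess π α k = 0 ↔ ratio π (α - k) = ratio π α := by
  rw [excess, show α + 1 - k = α - k + 1 by omega, div_sub_div_eq_ratio hπ]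
  have h1 := (hπ k).ne'
  have h2 := (hπ α).ne'
  have h3 := (hπ (α - k + 1)).ne'
  simp [h1, h2, h3, sub_eq_zero]

/-- If φ(α) > 0, then φ(k) ≥ φ(α) for k < α and φ(α+1) ≤ φ(α), so (at-2) can be divided by φ(α) and
the π(0) terms cancel. If φ(α) = 0, all excesses turn out to vanish. -/
theorem atThree_of_atOne_of_atTwo (hπ : ∀ n, 0 < π n) (hh : ∀ k, 1 ≤ k → 0 ≤ h k)
    (hr : AntitoneOn (ratio π) (Set.Ici 1)) (hne : ∃ k, 1 ≤ k ∧ h k ≠ 0)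
    (H1 : AtOne π h) (H2 : AtTwo π h) : AtThree π := by
  intro α hα
  have hα1 : 1 ≤ α := by omega
  rw [atThree_ineq_iff π hα1]
  have hφ : ∀ k, 1 ≤ k → 0 ≤ h k / π k := fun k hk => div_nonneg (hh k hk) (hπ k).le
  have hrπ : 0 ≤ ratio π α * π 1 := (mul_pos (ratio_pos hπ α) (hπ 1)).le
  rcases (hφ α hα1).lt_or_eq with hpos | h0
  · have h2 := (atTwo_ineq_iff hπ hα1).1 (H2 α hα1)
    have h3 : h α / π α * ∑ k ∈ Finset.Icc 1 (α - 1), excess π α k ≤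
        ∑ k ∈ Finset.Icc 1 (α - 1), h k / π k * excess π α k := by
      rw [Finset.mul_sum]
      refine Finset.sum_le_sum fun k hk => ?_
      rw [Finset.mem_Icc] at hk
      exact mul_le_mul_of_nonneg_right (H1.antitone_div hk.1 (by omega))
        (excess_nonneg hπ hr (by omega))
    have h4 := mul_le_mul_of_nonneg_left (H1 α hα1) (hπ 0).le
    refine le_of_mul_le_mul_left ?_ hpos
    linarith
  · -- `h` vanishes eventually, and this forces `r` to be constant
    obtain ⟨k₁, hk₁, hk₁'⟩ := hne
    have hk₁p : 0 < h k₁ / π k₁ := div_pos ((hh k₁ hk₁).lt_of_ne' hk₁') (hπ _)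
    -- β is the last point where h is positive; without one, φ would be positive from `k₁` on, and
    -- by (at-1) also at α.
    obtain ⟨β, hβ1, hβ, hβ0⟩ : ∃ β, 1 ≤ β ∧ 0 < h β / π β ∧ h (β + 1) / π (β + 1) = 0 := by
      by_contra! hcon
      have : ∀ k, k₁ ≤ k → 0 < h k / π k := fun k hk => by
        induction k, hk using Nat.le_induction with
        | base => exact hk₁p
        | succ k hk ih =>
          exact (hφ _ (by omega)).lt_of_ne' (hcon k (hk₁.trans hk) ih)
      rcases le_total k₁ α with h5 | h5
      · exact (this α h5).ne h0
      · linarith [H1.antitone_div hα1 h5]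
    have hz : ∀ γ, β + 1 ≤ γ → h γ / π γ = 0 := fun γ hγ =>
      le_antisymm (hβ0 ▸ H1.antitone_div (by omega) hγ) (hφ γ (by omega))
    -- Beyond β, (at-2) bounds a sum of nonnegative terms by 0. Since φ(k) > 0 for k ≤ β, the
    -- corresponding excesses vanish.
    have hconst : ∀ γ k, β + 1 ≤ γ → 1 ≤ k → k ≤ β → ratio π (γ - k) = ratio π γ := by
      intro γ k hγ hk hkβ
      have h2 := (atTwo_ineq_iff hπ (by omega)).1 (H2 γ (by omega))
      rw [hz γ hγ, hz (γ + 1) (by omega)] at h2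
      have hnn : ∀ i ∈ Finset.Icc 1 (γ - 1), 0 ≤ h i / π i * excess π γ i := fun i hi => by
        rw [Finset.mem_Icc] at hi
        exact mul_nonneg (hφ i hi.1) (excess_nonneg hπ hr (by omega))
      have h3 := (Finset.sum_eq_zero_iff_of_nonneg hnn).1
        (le_antisymm (by linarith) (Finset.sum_nonneg hnn)) k (by rw [Finset.mem_Icc]; omega)
      rcases mul_eq_zero.1 h3 with h4 | h4
      · exact absurd h4 (hβ.trans_le (H1.antitone_div hk hkβ)).ne'
      · exact (excess_eq_zero_iff hπ (by omega)).1 h4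
    have hend : ratio π (β + 1) = ratio π 1 := by
      have := hconst (β + 1) β le_rfl hβ1 le_rfl
      rwa [Nat.add_sub_cancel_left, eq_comm] at this
    have hge : ∀ γ, β + 1 ≤ γ → ratio π γ = ratio π 1 := fun γ hγ => by
      induction γ, hγ using Nat.le_induction with
      | base => exact hend
      | succ γ hγ ih =>
        rw [← ih, ← hconst (γ + 1) 1 (by omega) le_rfl hβ1, Nat.add_sub_cancel]
    -- Below β + 1, r is squeezed between r(1) and r(β+1), which are equal.
    have hall : ∀ γ, 1 ≤ γ → ratio π γ = ratio π 1 := fun γ hγ => by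
      rcases le_total (β + 1) γ with h5 | h5
      · exact hge γ h5
      · refine le_antisymm (hr (show 1 ≤ 1 from le_rfl) hγ hγ) ?_
        rw [← hend]
        exact hr hγ (show 1 ≤ β + 1 by omega) h5
    refine (Finset.sum_eq_zero fun k hk => ?_).trans_le hrπ
    rw [Finset.mem_Icc] at hk
    rw [excess_eq_zero_iff hπ (by omega), hall _ (by omega), hall α hα1]

theorem atOne_and_atTwo_iff_atThree (hπ : ∀ n, 0 < π n) {h₀ : ℝ} (h₀pos : 0 < h₀)
    (hh : ∀ k, 1 ≤ k → h k = h₀ * π k) : AtOne π h ∧ AtTwo π h ↔ AtThree π := by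
  have hφ : ∀ k, 1 ≤ k → h k / π k = h₀ := fun k hk => by
    rw [hh k hk, mul_div_cancel_right₀ _ (hπ k).ne']
  have key : ∀ α, 1 ≤ α →
      (∑ k ∈ Finset.Icc 1 α, h k * (π (α - k) / π α - π (α - k + 1) / π (α + 1)) ≤
        π 0 * (h (α + 1) / π (α + 1)) ↔
      1 / π α * ∑ i ∈ Finset.Icc 1 (α - 1), π i * π (α - i) ≤
        1 / π (α + 1) * ∑ i ∈ Finset.Icc 1 α, π i * π (α + 1 - i)) := by
    intro α hα
    rw [atTwo_ineq_iff hπ hα, atThree_ineq_iff π hα, hφ α hα, hφ (α + 1) (by omega),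
      Finset.sum_congr rfl (fun k hk => by rw [hφ k (Finset.mem_Icc.1 hk).1] :
        ∀ k ∈ Finset.Icc 1 (α - 1), h k / π k * excess π α k = h₀ * excess π α k),
      ← Finset.mul_sum, ← mul_add, mul_comm (π 0), mul_le_mul_iff_right₀ h₀pos]
    constructor <;> intro h1 <;> linarith
  refine ⟨fun H α hα => (key α (by omega)).1 (H.2 α (by omega)), fun H => ⟨fun α hα => ?_,
    fun α hα => (key α hα).2 ?_⟩⟩
  · rw [hφ α hα, hφ (α + 1) (by omega)]
  -- (at-3) starts at α = 2, while (at-2) includes α = 1. There the left sum of the at-3 inequality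
  -- is empty.
  · rcases hα.eq_or_lt with rfl | h2
    · simpa using (mul_pos (inv_pos.2 (hπ 2)) (mul_pos (hπ 1) (hπ 1))).le
    · exact H α h2

/-- A symmetric sum over `{1, …, 2n}` is twice the sum over the first half. -/
theorem sum_Icc_symm_even (f : ℕ → ℝ) (n : ℕ) (hf : ∀ i ∈ Finset.Icc 1 n, f (2 * n + 1 - i) = f i) :
    ∑ i ∈ Finset.Icc 1 (2 * n), f i = 2 * ∑ i ∈ Finset.Icc 1 n, f i := by
  have h1 : Finset.Icc 1 (2 * n) = Finset.Icc 1 n ∪ Finset.Icc (n + 1) (2 * n) := by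
    ext i; simp only [Finset.mem_union, Finset.mem_Icc]; omega
  have h2 : Disjoint (Finset.Icc 1 n) (Finset.Icc (n + 1) (2 * n)) := by
    rw [Finset.disjoint_left]; intro i; simp only [Finset.mem_Icc]; omega
  rw [h1, Finset.sum_union h2, two_mul (∑ i ∈ _, _), add_right_inj]
  refine Finset.sum_nbij' (fun i => 2 * n + 1 - i) (fun i => 2 * n + 1 - i) ?_ ?_ ?_ ?_ ?_
  · intro i; simp only [Finset.mem_Icc]; omega
  · intro i; simp only [Finset.mem_Icc]; omega
  · intro i; simp only [Finset.mem_Icc]; omega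
  · intro i; simp only [Finset.mem_Icc]; omega
  · intro i hi
    simp only [Finset.mem_Icc] at hi
    rw [← hf (2 * n + 1 - i) (by rw [Finset.mem_Icc]; omega)]
    congr 1; omega

/-- A symmetric sum over `{1, …, 2n+1}` is twice the sum over the first half, plus the middle
term. -/
theorem sum_Icc_symm_odd (f : ℕ → ℝ) (n : ℕ) (hf : ∀ i ∈ Finset.Icc 1 n, f (2 * n + 2 - i) = f i) :
    ∑ i ∈ Finset.Icc 1 (2 * n + 1), f i = 2 * ∑ i ∈ Finset.Icc 1 n, f i + f (n + 1) := by
  have h1 : Finset.Icc 1 (2 * n + 1) =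
      Finset.Icc 1 n ∪ insert (n + 1) (Finset.Icc (n + 2) (2 * n + 1)) := by
    ext i; simp only [Finset.mem_union, Finset.mem_insert, Finset.mem_Icc]; omega
  have h2 : Disjoint (Finset.Icc 1 n) (insert (n + 1) (Finset.Icc (n + 2) (2 * n + 1))) := by
    rw [Finset.disjoint_left]; intro i; simp only [Finset.mem_insert, Finset.mem_Icc]; omega
  have h3 : ∑ i ∈ Finset.Icc (n + 2) (2 * n + 1), f i = ∑ i ∈ Finset.Icc 1 n, f i := by
    refine Finset.sum_nbij' (fun i => 2 * n + 2 - i) (fun i => 2 * n + 2 - i) ?_ ?_ ?_ ?_ ?_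
    · intro i; simp only [Finset.mem_Icc]; omega
    · intro i; simp only [Finset.mem_Icc]; omega
    · intro i; simp only [Finset.mem_Icc]; omega
    · intro i; simp only [Finset.mem_Icc]; omega
    · intro i hi
      simp only [Finset.mem_Icc] at hi
      rw [← hf (2 * n + 2 - i) (by rw [Finset.mem_Icc]; omega)]
      congr 1; omega
  rw [h1, Finset.sum_union h2, Finset.sum_insert (by simp), h3]
  ring

/-! ### Products of ratios and the function F -/

theorem prod_ratio_Icc (hπ : ∀ n, 0 < π n) {m n : ℕ} (hmn : m ≤ n + 1) :
    ∏ j ∈ Finset.Icc m n, ratio π j = π m / π (n + 1) := by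
  rcases hmn.eq_or_lt with rfl | hlt
  · rw [Finset.Icc_eq_empty (by omega), Finset.prod_empty, div_self (hπ _).ne']
  · have h1 : m ≤ n := by omega
    clear hmn hlt
    induction n, h1 using Nat.le_induction with
    | base => rw [Finset.Icc_self, Finset.prod_singleton, ratio]
    | succ n hn ih =>
      rw [Finset.prod_Icc_succ_top (by omega), ih, ratio, div_mul_div_cancel₀ (hπ _).ne']

/-- The terms of `∑ π(i) π(α-i)`, rescaled, as quotients of products of ratios. -/
theorem prod_ratio_div_prod_ratio (hπ : ∀ n, 0 < π n) {α i : ℕ} (hi : 1 ≤ i) (hiα : i < α) :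
    (∏ j ∈ Finset.Icc (α - i) (α - 2), ratio π j) / ∏ j ∈ Finset.Icc 1 (i - 1), ratio π j =
      π i * π (α - i) / (π (α - 1) * π 1) := by
  rw [prod_ratio_Icc hπ (by omega), prod_ratio_Icc hπ (by omega),
    show i - 1 + 1 = i by omega, show α - 2 + 1 = α - 1 by omega]
  have h1 := (hπ 1).ne'
  have h2 := (hπ i).ne'
  have h3 := (hπ (α - 1)).ne'
  field_simp

theorem one_add_sum_prod_ratio (hπ : ∀ n, 0 < π n) {α m : ℕ} (hm : 1 ≤ m) (hmα : m < α) :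
    1 + ∑ i ∈ Finset.Icc 2 m,
        (∏ j ∈ Finset.Icc (α - i) (α - 2), ratio π j) / ∏ j ∈ Finset.Icc 1 (i - 1), ratio π j =
      (∑ i ∈ Finset.Icc 1 m, π i * π (α - i)) / (π (α - 1) * π 1) := by
  have h1 : Finset.Icc 1 m = insert 1 (Finset.Icc 2 m) := by
    ext i; simp only [Finset.mem_insert, Finset.mem_Icc]; omega
  have h2 := (hπ 1).ne'
  have h3 := (hπ (α - 1)).ne'
  rw [h1, Finset.sum_insert (by simp), add_div, Finset.sum_div]
  congr 1
  · field_simp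
  · refine Finset.sum_congr rfl fun i hi => ?_
    rw [Finset.mem_Icc] at hi
    exact prod_ratio_div_prod_ratio hπ (by omega) (by omega)

theorem one_add_sum_prod_ratio_succ (hπ : ∀ n, 0 < π n) {α m : ℕ} (hm : 1 ≤ m) (hmα : m ≤ α) :
    1 + ∑ i ∈ Finset.Icc 2 m,
        (∏ j ∈ Finset.Icc (α - i + 1) (α - 1), ratio π j) /
          ∏ j ∈ Finset.Icc 1 (i - 1), ratio π j =
      (∑ i ∈ Finset.Icc 1 m, π i * π (α + 1 - i)) / (π α * π 1) := by
  rw [show π α = π (α + 1 - 1) from rfl, ← one_add_sum_prod_ratio hπ hm (by omega)]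
  congr 1
  refine Finset.sum_congr rfl fun i hi => ?_
  rw [Finset.mem_Icc] at hi
  rw [show α - i + 1 = α + 1 - i by omega, show α - 1 = α + 1 - 2 by omega]

theorem neg_one_sub_eq {s t : ℝ} (h : 1 + s = t) : -1 - s = -t := by
  rw [← h]; ring

/-- Both sums are symmetric under reflection of the index, so each is twice its first half, plus a
middle term where the number of terms is odd. The middle term, with its factor 1/2 in F, belongs to
the shorter sum for even α and to the longer one for odd α. -/
theorem two_mul_critF (hπ : ∀ n, 0 < π n) {α : ℕ} (hα : 2 ≤ α) :
    2 * π 1 * ratio π (α - 1) * critF (ratio π) α =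
      1 / π (α + 1) * ∑ i ∈ Finset.Icc 1 α, π i * π (α + 1 - i) -
        1 / π α * ∑ i ∈ Finset.Icc 1 (α - 1), π i * π (α - i) := by
  have e1 := (hπ 1).ne'
  have e2 := (hπ α).ne'
  have e3 := (hπ (α - 1)).ne'
  have e4 := (hπ (α + 1)).ne'
  have hr1 : ratio π (α - 1) = π (α - 1) / π α := by
    rw [ratio, Nat.sub_add_cancel (by omega)]
  have hr2 : ratio π α / ratio π (α - 1) = π α ^ 2 / (π (α - 1) * π (α + 1)) := by
    rw [hr1, ratio]; field_simp
  rcases Nat.even_or_odd' α with ⟨n, rfl | rfl⟩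
  · rcases (show 1 ≤ n by omega).eq_or_lt with rfl | hn
    · have f2 := (hπ 2).ne'
      have f3 := (hπ 3).ne'
      simp only [Nat.mul_one] at *
      rw [critF, if_pos rfl]
      simp [Finset.sum_Icc_succ_top, ratio]
      field_simp
      ring
    · obtain ⟨l, rfl⟩ : ∃ l, n = l + 1 := ⟨n - 1, by omega⟩
      have h1 := one_add_sum_prod_ratio hπ (α := 2 * (l + 1)) (m := l + 1) (by omega) (by omega)
      have h2 := one_add_sum_prod_ratio_succ hπ (α := 2 * (l + 1)) (m := l + 1)
        (by omega) (by omega)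
      have h3 := prod_ratio_div_prod_ratio hπ (α := 2 * (l + 1)) (i := l + 1)
        (by omega) (by omega)
      have h4 := sum_Icc_symm_even (fun i => π i * π (2 * (l + 1) + 1 - i)) (l + 1) fun i hi => by
        rw [Finset.mem_Icc] at hi
        rw [show 2 * (l + 1) + 1 - (2 * (l + 1) + 1 - i) = i by omega, mul_comm]
      have h5 := sum_Icc_symm_odd (fun i => π i * π (2 * (l + 1) - i)) l fun i hi => by
        rw [Finset.mem_Icc] at hi
        rw [show 2 * (l + 1) - (2 * l + 2 - i) = i by omega,
          show 2 * l + 2 - i = 2 * (l + 1) - i by omega, mul_comm]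
      have h6 := Finset.sum_Icc_succ_top (show 1 ≤ l + 1 by omega)
        (fun i => π i * π (2 * (l + 1) - i))
      rw [show 2 * l + 1 = 2 * (l + 1) - 1 by omega] at h5
      rw [critF, if_neg (by omega), if_neg (by omega), if_pos (even_two_mul _),
        show 2 * (l + 1) / 2 = l + 1 by omega, h2, hr2, hr1, neg_one_sub_eq h1, h4, h5]
      rw [show 2 * (l + 1) - (l + 1) = l + 1 by omega] at h3 h6 ⊢
      rw [h3, h6]
      field_simp
      ring
  · rcases (show 1 ≤ n by omega).eq_or_lt with rfl | hn
    · have f2 := (hπ 2).ne'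
      have f3 := (hπ 3).ne'
      have f4 := (hπ 4).ne'
      rw [critF, if_neg (by norm_num), if_pos (by norm_num)]
      simp [Finset.sum_Icc_succ_top, ratio]
      field_simp
      ring
    · have h1 := one_add_sum_prod_ratio hπ (α := 2 * n + 1) (m := n) (by omega) (by omega)
      have h2 := one_add_sum_prod_ratio_succ hπ (α := 2 * n + 1) (m := n) (by omega) (by omega)
      have h3 := prod_ratio_div_prod_ratio hπ (α := 2 * n + 1 + 1) (i := n + 1)
        (by omega) (by omega)
      have h4 := sum_Icc_symm_even (fun i => π i * π (2 * n + 1 - i)) n fun i hi => by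
        rw [Finset.mem_Icc] at hi
        rw [show 2 * n + 1 - (2 * n + 1 - i) = i by omega, mul_comm]
      have h5 := sum_Icc_symm_odd (fun i => π i * π (2 * n + 1 + 1 - i)) n fun i hi => by
        rw [Finset.mem_Icc] at hi
        rw [show 2 * n + 1 + 1 - (2 * n + 2 - i) = i by omega, mul_comm]
      rw [show 2 * n + 1 + 1 - (n + 1) = n + 1 by omega] at h3 h5
      rw [show 2 * n + 1 + 1 - 2 = 2 * n + 1 - 1 by omega, Nat.add_sub_cancel (m := 1),
        Nat.add_sub_cancel (m := 1)] at h3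
      rw [critF, if_neg (by omega), if_neg (by omega), if_neg (by simp),
        show (2 * n + 1) / 2 = n by omega, show (2 * n + 1 + 1) / 2 = n + 1 by omega,
        show (2 * n + 1 - 1) / 2 = n by omega, h2, hr2, hr1, neg_one_sub_eq h1, h5]
      simp only [Nat.add_sub_cancel] at h3 h4 e3 ⊢
      rw [h3, h4]
      field_simp
      ring

theorem atThree_iff_critF (hπ : ∀ n, 0 < π n) :
    AtThree π ↔ ∀ α : ℕ, 2 ≤ α → 0 ≤ critF (ratio π) α := by
  refine forall₂_congr fun α hα => ?_
  have hpos : 0 < 2 * π 1 * ratio π (α - 1) :=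
    mul_pos (mul_pos two_pos (hπ 1)) (ratio_pos hπ _)
  rw [← mul_nonneg_iff_of_pos_left hpos, two_mul_critF hπ hα, sub_nonneg]

end Algebra

end MassMigration

end

noncomputable section

namespace MassMigration

/-! ### A minimum principle -/

section MinimumPrinciple

/-- Lets the evolution be restarted at a time from which w is negative, so that upper bounds there
may drop w. -/
theorem exists_last_nonneg {w : ℝ → ℝ} {t : ℝ} (ht : 0 ≤ t) (hw : ContinuousOn w (Set.Icc 0 t))
    (h0 : 0 ≤ w 0) :
    ∃ t₀ ∈ Set.Icc 0 t, 0 ≤ w t₀ ∧ ∀ s, t₀ < s → s ≤ t → w s < 0 := by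
  have hcl : IsClosed (Set.Icc 0 t ∩ w ⁻¹' Set.Ici 0) :=
    hw.preimage_isClosed_of_isClosed isClosed_Icc isClosed_Ici
  have hco : IsCompact (Set.Icc 0 t ∩ w ⁻¹' Set.Ici 0) :=
    isCompact_Icc.of_isClosed_subset hcl Set.inter_subset_left
  obtain ⟨t₀, ht₀, hmax⟩ := hco.exists_isGreatest ⟨0, ⟨le_rfl, ht⟩, h0⟩
  refine ⟨t₀, ht₀.1, ht₀.2, fun s hs hst => ?_⟩
  by_contra! hcon
  exact absurd (hmax ⟨⟨ht₀.1.1.trans hs.le, hst⟩, hcon⟩) (not_le.2 hs)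

/-- A bounded solution of `w(t) = w(0) + ∫₀ᵗ D(s) ds`, where `D(s)` is bounded from below as the
image of `w(s)` under a Markov generator with bounded rates would be, stays nonnegative. -/
theorem nonneg_of_integral_eq {I : Type*} {w D : ℝ → I → ℝ} {q : I → ℝ} {C M : ℝ}
    (hq : ∀ i, 0 ≤ q i) (hqC : ∀ i, q i ≤ C) (hC : 0 ≤ C) (hM : ∀ s i, |w s i| ≤ M)
    (hint : ∀ i t, 0 ≤ t → IntervalIntegrable (fun s => D s i) volume 0 t)
    (heq : ∀ i t, 0 ≤ t → w t i = w 0 i + ∫ s in (0 : ℝ)..t, D s i)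
    (h0 : ∀ i, 0 ≤ w 0 i)
    (hD : ∀ s m, 0 ≤ s → (∀ j, -m ≤ w s j) → ∀ i, -(q i * (m + w s i)) ≤ D s i)
    {t : ℝ} (ht : 0 ≤ t) (i : I) : 0 ≤ w t i := by
  have hM0 : 0 ≤ M := (abs_nonneg _).trans (hM 0 i)
  -- Iterated improvement of the bound: integrating the n-th lower bound at rate C gives the next
  -- term of the exponential series, which tends to 0.
  have key : ∀ n : ℕ, ∀ t, 0 ≤ t → ∀ i, -(M * ((C * t) ^ n / n.factorial)) ≤ w t i := by
    intro n
    induction n with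
    | zero => intro t _ i; simpa using neg_le_of_abs_le (hM t i)
    | succ n ih =>
      intro t ht i
      have hcont : ContinuousOn (fun s => w s i) (Set.Icc 0 t) := by
        have h1 := intervalIntegral.continuousOn_primitive_interval (μ := volume)
          (f := fun s => D s i) (a := 0) (b := t)
          ((intervalIntegrable_iff' (by simp)).1 (hint i t ht))
        rw [Set.uIcc_of_le ht] at h1
        exact (continuousOn_const.add h1).congr fun s hs => heq i s hs.1
      obtain ⟨t₀, ⟨ht₀, ht₀t⟩, hw₀, hneg⟩ := exists_last_nonneg ht hcont (h0 i)
      have hint' : IntervalIntegrable (fun s => D s i) volume t₀ t :=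
        (hint i t₀ ht₀).symm.trans (hint i t ht)
      have h1 : w t i = w t₀ i + ∫ s in t₀..t, D s i := by
        rw [heq i t ht, heq i t₀ ht₀, add_assoc,
          intervalIntegral.integral_add_adjacent_intervals (hint i t₀ ht₀) hint']
      have h2 : ∫ s in t₀..t, -(C ^ (n + 1) * M / n.factorial * s ^ n) ≤
          ∫ s in t₀..t, D s i := by
        refine intervalIntegral.integral_mono_on_of_le_Ioo ht₀t
          (Continuous.intervalIntegrable (by fun_prop) _ _) hint' fun s hs => ?_
        have hs0 : 0 ≤ s := ht₀.trans hs.1.le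
        have hm : 0 ≤ M * ((C * s) ^ n / n.factorial) := by positivity
        refine le_trans ?_ (hD s _ hs0 (fun j => ih s hs0 j) i)
        rw [neg_le_neg_iff]
        -- After `t₀` the value `w s i` is negative, so it can be discarded.
        have h3 : q i * (M * ((C * s) ^ n / n.factorial) + w s i) ≤
            C * (M * ((C * s) ^ n / n.factorial)) :=
          mul_le_mul_of_nonneg (hqC i) (by linarith [hneg s hs.1 hs.2.le]) (hq i) hm
        refine h3.trans_eq ?_
        rw [mul_pow]
        ring
      rw [intervalIntegral.integral_neg, intervalIntegral.integral_const_mul, integral_pow] at h2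
      have h4 : (0 : ℝ) ≤ C ^ (n + 1) * M / n.factorial * (t₀ ^ (n + 1) / (n + 1)) := by positivity
      have h5 : M * ((C * t) ^ (n + 1) / ((n + 1).factorial : ℝ)) =
          C ^ (n + 1) * M / n.factorial * (t ^ (n + 1) / (n + 1)) := by
        rw [Nat.factorial_succ, Nat.cast_mul, Nat.cast_succ, mul_pow]
        have : (n.factorial : ℝ) ≠ 0 := by positivity
        have : (n + 1 : ℝ) ≠ 0 := by positivity
        field_simp
      rw [h5, h1]
      rw [sub_div, mul_sub] at h2
      linarith
  have hlim : Filter.Tendsto (fun n : ℕ => -(M * ((C * t) ^ n / n.factorial))) Filter.atTop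
      (nhds (-(M * 0))) :=
    ((FloorSemiring.tendsto_pow_div_factorial_atTop (C * t)).const_mul M).neg
  rw [mul_zero, neg_zero] at hlim
  exact le_of_tendsto' hlim fun n => key n t ht i

end MinimumPrinciple

/-! ### Coupling at a single site -/

section SingleSite

theorem sum_Icc_one_eq_sum_range (f : ℕ → ℝ) (n : ℕ) :
    ∑ k ∈ Finset.Icc 1 n, f k = ∑ k ∈ Finset.range n, f (k + 1) := by
  induction n with
  | zero => simp
  | succ n ih => rw [Finset.sum_Icc_succ_top (by omega), ih, Finset.sum_range_succ]

theorem sum_Icc_eq_add {f : ℕ → ℝ} {m n : ℕ} (h : m ≤ n) :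
    ∑ k ∈ Finset.Icc m n, f k = f m + ∑ k ∈ Finset.Icc (m + 1) n, f k := by
  rw [← Finset.insert_Icc_add_one_left_eq_Icc h, Finset.sum_insert (by simp)]

/-- Domination of the tails of the rates, in the form needed for the coupling of configurations
which differ by one particle. -/
def TailCond (c : ℕ → ℕ → ℝ) : Prop :=
  ∀ α k : ℕ, 1 ≤ k → k ≤ α →
    ∑ l ∈ Finset.Icc (k + 1) (α + 1), c (α + 1) l ≤ ∑ l ∈ Finset.Icc k α, c α l ∧
    ∑ l ∈ Finset.Icc k α, c α l ≤ ∑ l ∈ Finset.Icc k (α + 1), c (α + 1) l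

/-- If `k` particles jump with rate `c k` from a pile and with rate `c' k` from the pile with one
more particle, a coupling in which the jumps are of sizes `(k, k)` or `(k, k + 1)` exists. -/
theorem coupled_sum_ge {c c' V Z : ℕ → ℝ} {α : ℕ} {m : ℝ}
    (hA : ∀ k, 1 ≤ k → k ≤ α →
      ∑ l ∈ Finset.Icc (k + 1) (α + 1), c' l ≤ ∑ l ∈ Finset.Icc k α, c l)
    (hB : ∀ k, k ≤ α →
      ∑ l ∈ Finset.Icc (k + 1) α, c l ≤ ∑ l ∈ Finset.Icc (k + 1) (α + 1), c' l)
    (h1 : ∀ k, k ≤ α → -m ≤ Z k - V k) (h2 : ∀ k, k ≤ α → -m ≤ Z (k + 1) - V k) :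
    -((∑ k ∈ Finset.Icc 1 (α + 1), c' k) * (m + (Z 0 - V 0))) ≤
      ∑ k ∈ Finset.Icc 1 (α + 1), c' k * (Z k - Z 0) - ∑ k ∈ Finset.Icc 1 α, c k * (V k - V 0) := by
  -- `A k` is the rate of the coupled jump (k, k), and `B k` that of (k, k + 1). The identities `hc`
  -- and `hc'` say that the marginal rates are right; `B 0` is the larger pile losing one particle
  -- alone.
  set A : ℕ → ℝ := fun k =>
    ∑ l ∈ Finset.Icc k α, c l - ∑ l ∈ Finset.Icc (k + 1) (α + 1), c' l with hAdef
  set B : ℕ → ℝ := fun k =>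
    ∑ l ∈ Finset.Icc (k + 1) (α + 1), c' l - ∑ l ∈ Finset.Icc (k + 1) α, c l with hBdef
  have hc : ∀ k, k < α → c (k + 1) = A (k + 1) + B (k + 1) := fun k hk => by
    simp only [hAdef, hBdef]
    rw [sum_Icc_eq_add (f := c) (show k + 1 ≤ α from hk)]
    ring
  have hc' : ∀ k, k < α + 1 → c' (k + 1) = A (k + 1) + B k := fun k hk => by
    simp only [hAdef, hBdef]
    rw [sum_Icc_eq_add (f := c') (show k + 1 ≤ α + 1 from hk)]
    ring
  have hAlast : A (α + 1) = 0 := by simp [hAdef]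
  have e1 : ∑ k ∈ Finset.range (α + 1), c' (k + 1) * (Z (k + 1) - V 0 + m) =
      ∑ k ∈ Finset.range α, A (k + 1) * (Z (k + 1) - V 0 + m) +
        ∑ k ∈ Finset.range (α + 1), B k * (Z (k + 1) - V 0 + m) := by
    have : ∑ k ∈ Finset.range α, A (k + 1) * (Z (k + 1) - V 0 + m) =
        ∑ k ∈ Finset.range (α + 1), A (k + 1) * (Z (k + 1) - V 0 + m) := by
      rw [Finset.sum_range_succ, hAlast, zero_mul, add_zero]
    rw [this, ← Finset.sum_add_distrib]
    exact Finset.sum_congr rfl fun k hk => by rw [hc' k (Finset.mem_range.1 hk)]; ring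
  have e2 : ∑ k ∈ Finset.range α, c (k + 1) * (V (k + 1) - V 0) =
      ∑ k ∈ Finset.range α, A (k + 1) * (V (k + 1) - V 0) +
        ∑ k ∈ Finset.range (α + 1), B k * (V k - V 0) := by
    rw [Finset.sum_range_succ', sub_self, mul_zero, add_zero, ← Finset.sum_add_distrib]
    exact Finset.sum_congr rfl fun k hk => by rw [hc k (Finset.mem_range.1 hk)]; ring
  have e3 : 0 ≤ ∑ k ∈ Finset.range α, A (k + 1) * (Z (k + 1) - V 0 + m) -
      ∑ k ∈ Finset.range α, A (k + 1) * (V (k + 1) - V 0) := by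
    rw [← Finset.sum_sub_distrib]
    refine Finset.sum_nonneg fun k hk => ?_
    rw [Finset.mem_range] at hk
    rw [← mul_sub]
    exact mul_nonneg (sub_nonneg.2 (hA _ (by omega) hk)) (by linarith [h1 (k + 1) hk])
  have e4 : 0 ≤ ∑ k ∈ Finset.range (α + 1), B k * (Z (k + 1) - V 0 + m) -
      ∑ k ∈ Finset.range (α + 1), B k * (V k - V 0) := by
    rw [← Finset.sum_sub_distrib]
    refine Finset.sum_nonneg fun k hk => ?_
    rw [Finset.mem_range, Nat.lt_succ_iff] at hk
    rw [← mul_sub]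
    exact mul_nonneg (sub_nonneg.2 (hB _ hk)) (by linarith [h2 k hk])
  have e5 : ∑ k ∈ Finset.range (α + 1), c' (k + 1) * (Z (k + 1) - V 0 + m) =
      ∑ k ∈ Finset.range (α + 1), c' (k + 1) * (Z (k + 1) - Z 0) +
        (∑ k ∈ Finset.range (α + 1), c' (k + 1)) * (m + (Z 0 - V 0)) := by
    rw [Finset.sum_mul, ← Finset.sum_add_distrib]
    exact Finset.sum_congr rfl fun k _ => by ring
  simp only [sum_Icc_one_eq_sum_range]
  linarith

theorem TailCond.tail_le {c : ℕ → ℕ → ℝ} (hc : TailCond c) (hnn : ∀ α k, 0 ≤ c α k) {α k : ℕ}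
    (hk : k ≤ α) :
    ∑ l ∈ Finset.Icc (k + 1) α, c α l ≤ ∑ l ∈ Finset.Icc (k + 1) (α + 1), c (α + 1) l := by
  rcases hk.eq_or_lt with rfl | hlt
  · simpa using hnn _ _
  · exact (hc α (k + 1) (by omega) hlt).2

theorem zrpRate_nonneg {π h : ℕ → ℝ} (hπ : ∀ n, 0 < π n) (hh : ∀ k, 1 ≤ k → 0 ≤ h k)
    (α β k : ℕ) : 0 ≤ zrpRate π h α β k := by
  unfold zrpRate
  split_ifs with hk
  · exact mul_nonneg (div_pos (hπ _) (hπ _)).le (hh k hk.1)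
  · exact le_rfl

theorem sum_range_mul_div_eq_tail (π h : ℕ → ℝ) {α m : ℕ} (hm : m ≤ α) :
    ∑ j ∈ Finset.range m, π j * (h (α - j) / π α) =
      ∑ l ∈ Finset.Icc (α + 1 - m) α, zrpRate π h α 0 l := by
  refine Finset.sum_nbij' (fun j => α - j) (fun k => α - k) ?_ ?_ ?_ ?_ ?_
  · intro j hj; simp only [Finset.mem_range, Finset.mem_Icc] at *; omega
  · intro j hj; simp only [Finset.mem_range, Finset.mem_Icc] at *; omega
  · intro j hj; simp only [Finset.mem_range] at *; omega
  · intro j hj; simp only [Finset.mem_Icc] at *; omega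
  · intro j hj
    simp only [Finset.mem_range] at hj
    rw [zrpRate, if_pos (by omega), Nat.sub_sub_self (by omega)]
    ring

/-- The substitution l = α - j turns the sums in (A) into tails starting at k = α + 1 - m; the right
side of (A) is the extra term that extends the tail for α + 1 from k + 1 down to k. -/
theorem attractCond_iff_tailCond (π h : ℕ → ℝ) :
    AttractCond π h ↔ TailCond (fun α k => zrpRate π h α 0 k) := by
  have key : ∀ α m, 1 ≤ m → m ≤ α →
      ((0 ≤ ∑ j ∈ Finset.range m, π j * (h (α - j) / π α - h (α + 1 - j) / π (α + 1)) ∧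
        ∑ j ∈ Finset.range m, π j * (h (α - j) / π α - h (α + 1 - j) / π (α + 1)) ≤
          π m * h (α + 1 - m) / π (α + 1)) ↔
      (∑ l ∈ Finset.Icc (α + 1 - m + 1) (α + 1), zrpRate π h (α + 1) 0 l ≤
          ∑ l ∈ Finset.Icc (α + 1 - m) α, zrpRate π h α 0 l ∧
        ∑ l ∈ Finset.Icc (α + 1 - m) α, zrpRate π h α 0 l ≤
          ∑ l ∈ Finset.Icc (α + 1 - m) (α + 1), zrpRate π h (α + 1) 0 l)) := by
    intro α m hm hmα
    have h1 := sum_range_mul_div_eq_tail π h hmα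
    have h2 := sum_range_mul_div_eq_tail π h (show m ≤ α + 1 by omega)
    have h3 := sum_range_mul_div_eq_tail π h (show m + 1 ≤ α + 1 by omega)
    rw [Finset.sum_range_succ, show α + 1 + 1 - (m + 1) = α + 1 - m by omega] at h3
    rw [show α + 1 + 1 - m = α + 1 - m + 1 by omega] at h2
    rw [← h1, ← h2, ← h3]
    simp only [mul_sub, Finset.sum_sub_distrib, mul_div_assoc]
    constructor <;> rintro ⟨h4, h5⟩ <;> constructor <;> linarith
  constructor
  · intro H α k hk hkα
    have := (key α (α + 1 - k) (by omega) (by omega)).1 (H α _ (by omega) (by omega))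
    rwa [show α + 1 - (α + 1 - k) = k by omega] at this
  · intro H α m hm hmα
    exact (key α m hm hmα).2 (H α _ (by omega) (by omega))

end SingleSite

end MassMigration

end

noncomputable section

namespace MassMigration

/-! ### Configurations with finitely many particles -/

section Finite

variable {X : Type*}

/-- A finitely supported function as a configuration. -/
def toConfig (a : X → ℝ≥0) (η : X →₀ ℕ) : Config a :=
  ⟨η, summable_of_hasFiniteSupport <| η.hasFiniteSupport.subset fun x hx => by
    contrapose! hx
    simp [Function.notMem_support.1 hx]⟩

@[simp] theorem toConfig_apply (a : X → ℝ≥0) (η : X →₀ ℕ) (x : X) : toConfig a η x = η x := rfl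

theorem Config.ext {a : X → ℝ≥0} {η ζ : Config a} (h : ∀ x, η x = ζ x) : η = ζ :=
  Subtype.ext (funext h)

theorem toConfig_mono (a : X → ℝ≥0) : Monotone (toConfig a) := fun _ _ h => h

theorem toConfig_support_finite (a : X → ℝ≥0) (η : X →₀ ℕ) :
    (Function.support (toConfig a η : X → ℕ)).Finite := η.hasFiniteSupport

/-- The jump of `k` particles from `x` to `y`. -/
def jump (η : X →₀ ℕ) (x y : X) (k : ℕ) : X →₀ ℕ :=
  η - Finsupp.single x k + Finsupp.single y k

theorem single_le_of_le {η : X →₀ ℕ} {x : X} {k : ℕ} (hk : k ≤ η x) : Finsupp.single x k ≤ η :=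
  Finsupp.single_le_iff.2 hk

theorem degree_jump {η : X →₀ ℕ} {x : X} {k : ℕ} (hk : k ≤ η x) (y : X) :
    (jump η x y k).degree = η.degree := by
  conv_rhs => rw [← tsub_add_cancel_of_le (single_le_of_le hk)]
  simp only [jump, map_add, Finsupp.degree_single]

theorem jump_add_single {η : X →₀ ℕ} {x : X} {k : ℕ} (hk : k ≤ η x) (y z : X) (l : ℕ) :
    jump (η + Finsupp.single z l) x y k = jump η x y k + Finsupp.single z l := by
  rw [jump, jump, ← tsub_add_eq_add_tsub (single_le_of_le hk), add_right_comm]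

/-- The extra particle travels along: after a coupled jump (k, k + 1) the discrepancy sits at y
instead of x. -/
theorem jump_succ_add_single {η : X →₀ ℕ} {x : X} {k : ℕ} (y : X) :
    jump (η + Finsupp.single x 1) x y (k + 1) = jump η x y k + Finsupp.single y 1 := by
  rw [jump, jump, Finsupp.single_add, Finsupp.single_add, add_tsub_add_eq_tsub_right, add_assoc]

theorem jump_zero (η : X →₀ ℕ) (x y : X) : jump η x y 0 = η := by simp [jump]

theorem move_toConfig {a : X → ℝ≥0} {η : X →₀ ℕ} {x : X} {k : ℕ} (hk : k ≤ η x) (y : X) :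
    (toConfig a η).move x y k = toConfig a (jump η x y k) := by
  classical
  refine Config.ext fun z => ?_
  change moveFun η x y k z = jump η x y k z
  simp only [moveFun, jump, not_lt.2 hk, or_false, Finsupp.add_apply, Finsupp.tsub_apply,
    Finsupp.single_apply]
  by_cases hxy : x = y
  · subst hxy
    by_cases hz : x = z
    · subst hz; simp; omega
    · simp [hz]
  · by_cases hzx : z = x
    · subst hzx; simp [hxy, Ne.symm hxy]
    · by_cases hzy : z = y
      · subst hzy; simp [hzx, Ne.symm hzx]
      · simp [hxy, hzx, hzy, Ne.symm hzx, Ne.symm hzy]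

variable (p : X → X → ℝ) (c : ℕ → ℕ → ℝ)

/-- The contribution to the generator of the jumps from `x` to `y`. -/
def bondGen (v : (X →₀ ℕ) → ℝ) (η : X →₀ ℕ) (x y : X) : ℝ :=
  ∑ k ∈ Finset.Icc 1 (η x), c (η x) k * (v (jump η x y k) - v η)

/-- The contribution to the generator of the jumps from `x`. -/
def siteGen (v : (X →₀ ℕ) → ℝ) (η : X →₀ ℕ) (x : X) : ℝ :=
  ∑' y, p x y * bondGen c v η x y

/-- The generator on functions of the configurations with finitely many particles. -/
def finGen (v : (X →₀ ℕ) → ℝ) (η : X →₀ ℕ) : ℝ := ∑ x ∈ η.support, siteGen p c v η x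

/-- The total rate at which a pile of `n` particles loses mass. -/
def pileRate (n : ℕ) : ℝ := ∑ k ∈ Finset.Icc 1 n, c n k

/-- The total jump rate. -/
def totalRate (η : X →₀ ℕ) : ℝ := ∑ x ∈ η.support, pileRate c (η x)

variable {p c}

theorem siteGen_of_eq_zero {v : (X →₀ ℕ) → ℝ} {η : X →₀ ℕ} {x : X} (hx : η x = 0) :
    siteGen p c v η x = 0 := by
  simp [siteGen, bondGen, hx]

theorem finGen_eq_sum {v : (X →₀ ℕ) → ℝ} {η : X →₀ ℕ} {A : Finset X} (hA : η.support ⊆ A) :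
    finGen p c v η = ∑ x ∈ A, siteGen p c v η x :=
  Finset.sum_subset hA fun _ _ hx => siteGen_of_eq_zero (Finsupp.notMem_support_iff.1 hx)

theorem generator_toConfig {a : X → ℝ≥0} (u : Config a → ℝ) (η : X →₀ ℕ) :
    generator p (fun α _ k => c α k) u (toConfig a η) =
      finGen p c (fun ξ => u (toConfig a ξ)) η := by
  have h1 : ∀ x y, (p x y * ∑ k ∈ Finset.Icc 1 (toConfig a η x),
      c (toConfig a η x) k * (u ((toConfig a η).move x y k) - u (toConfig a η))) =
      p x y * bondGen c (fun ξ => u (toConfig a ξ)) η x y := by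
    intro x y
    congr 1
    refine Finset.sum_congr rfl fun k hk => ?_
    rw [move_toConfig (Finset.mem_Icc.1 hk).2]
    rfl
  simp only [generator, h1]
  exact tsum_eq_sum fun x hx => siteGen_of_eq_zero (Finsupp.notMem_support_iff.1 hx)

variable (hp : IsTransition p) (hc : ∀ α k, 0 ≤ c α k)

include hc in
theorem pileRate_nonneg (n : ℕ) : 0 ≤ pileRate c n := Finset.sum_nonneg fun _ _ => hc _ _

include hc in
theorem totalRate_nonneg (η : X →₀ ℕ) : 0 ≤ totalRate c η :=
  Finset.sum_nonneg fun _ _ => pileRate_nonneg hc _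

include hc in
/-- The total jump rate is bounded in terms of the number of particles. -/
theorem totalRate_le (η : X →₀ ℕ) :
    totalRate c η ≤ η.degree * ∑ n ∈ Finset.range (η.degree + 1), pileRate c n := by
  rw [Finsupp.degree_apply, Nat.cast_sum, Finset.sum_mul]
  refine Finset.sum_le_sum fun x hx => ?_
  have h1 : pileRate c (η x) ≤ ∑ n ∈ Finset.range (η.degree + 1), pileRate c n :=
    Finset.single_le_sum (f := fun n => pileRate c n) (fun n _ => pileRate_nonneg hc n)
      (Finset.mem_range.2 (Nat.lt_succ_of_le (Finsupp.le_degree x η)))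
  have h2 : (1 : ℝ) ≤ η x := by
    exact_mod_cast Nat.one_le_iff_ne_zero.2 (Finsupp.mem_support_iff.1 hx)
  exact h1.trans (le_mul_of_one_le_left ((pileRate_nonneg hc _).trans h1) h2)

include hp in
theorem summable_mul_of_bdd {J : X → ℝ} {b : ℝ} (hJ : ∀ y, |J y| ≤ b) (x : X) :
    Summable fun y => p x y * J y := by
  refine Summable.of_norm_bounded ((hp.2 x).summable.mul_right b) fun y => ?_
  rw [Real.norm_eq_abs, abs_mul, abs_of_nonneg (hp.1 x y)]
  exact mul_le_mul_of_nonneg_left (hJ y) (hp.1 x y)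

include hp in
theorem le_tsum_mul {J : X → ℝ} {b : ℝ} {x : X} (hs : Summable fun y => p x y * J y)
    (hJ : ∀ y, b ≤ J y) : b ≤ ∑' y, p x y * J y := by
  have h1 : ∑' y, p x y * b = b := by rw [tsum_mul_right, (hp.2 x).tsum_eq, one_mul]
  rw [← h1]
  exact ((hp.2 x).summable.mul_right b).tsum_le_tsum
    (fun y => mul_le_mul_of_nonneg_left (hJ y) (hp.1 x y)) hs

include hc in
theorem abs_bondGen_le {v : (X →₀ ℕ) → ℝ} {η : X →₀ ℕ} {M : ℝ}
    (hv : ∀ ξ, ξ.degree = η.degree → |v ξ| ≤ M) (x y : X) :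
    |bondGen c v η x y| ≤ pileRate c (η x) * (2 * M) := by
  rw [pileRate, Finset.sum_mul]
  refine (Finset.abs_sum_le_sum_abs _ _).trans (Finset.sum_le_sum fun k hk => ?_)
  rw [abs_mul, abs_of_nonneg (hc _ _)]
  refine mul_le_mul_of_nonneg_left ?_ (hc _ _)
  have h1 := hv _ (degree_jump (Finset.mem_Icc.1 hk).2 y)
  have h2 := hv η rfl
  exact (abs_sub _ _).trans (by linarith)

include hp hc in
theorem summable_bondGen {v : (X →₀ ℕ) → ℝ} {η : X →₀ ℕ} {M : ℝ}
    (hv : ∀ ξ, ξ.degree = η.degree → |v ξ| ≤ M) (x : X) :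
    Summable fun y => p x y * bondGen c v η x y :=
  summable_mul_of_bdd hp (abs_bondGen_le hc hv x) x

include hp hc in
theorem abs_finGen_le {v : (X →₀ ℕ) → ℝ} {η : X →₀ ℕ} {M : ℝ}
    (hv : ∀ ξ, ξ.degree = η.degree → |v ξ| ≤ M) :
    |finGen p c v η| ≤ totalRate c η * (2 * M) := by
  rw [totalRate, Finset.sum_mul]
  refine (Finset.abs_sum_le_sum_abs _ _).trans (Finset.sum_le_sum fun x _ => ?_)
  have hb := abs_bondGen_le hc hv x
  have hs := summable_bondGen hp hc hv x
  refine abs_le.2 ⟨le_tsum_mul hp hs fun y => (abs_le.1 (hb y)).1, ?_⟩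
  have h1 := le_tsum_mul hp (J := fun y => -bondGen c v η x y) (by simpa using hs.neg)
    fun y => neg_le_neg (abs_le.1 (hb y)).2
  simp only [mul_neg, tsum_neg] at h1
  exact neg_le_neg_iff.1 h1

include hp hc in
theorem finGen_sub {u v : (X →₀ ℕ) → ℝ} {η : X →₀ ℕ} {M N : ℝ}
    (hu : ∀ ξ, ξ.degree = η.degree → |u ξ| ≤ M) (hv : ∀ ξ, ξ.degree = η.degree → |v ξ| ≤ N) :
    finGen p c (fun ξ => u ξ - v ξ) η = finGen p c u η - finGen p c v η := by
  rw [finGen, finGen, finGen, ← Finset.sum_sub_distrib]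
  refine Finset.sum_congr rfl fun x _ => ?_
  rw [siteGen, siteGen, siteGen,
    ← (summable_bondGen hp hc hu x).tsum_sub (summable_bondGen hp hc hv x)]
  refine tsum_congr fun y => ?_
  rw [← mul_sub, bondGen, bondGen, bondGen, ← Finset.sum_sub_distrib]
  congr 1
  exact Finset.sum_congr rfl fun k _ => by ring

include hc in
-- If the extra particle is at the departure site, the piles have α and α + 1 particles and
-- `coupled_sum_ge` applies; otherwise the two piles are equal and jump together. Jumps conserve the
-- degree, so `hm` is needed on one level only.
theorem bondGen_add_single_ge (hT : TailCond c) {v : (X →₀ ℕ) → ℝ} {η : X →₀ ℕ} {m : ℝ}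
    (hm : ∀ ξ z, ξ.degree = η.degree → -m ≤ v (ξ + Finsupp.single z 1) - v ξ) (x y z : X) :
    -(pileRate c ((η + Finsupp.single z 1 : X →₀ ℕ) x) *
        (m + (v (η + Finsupp.single z 1) - v η))) ≤
      bondGen c v (η + Finsupp.single z 1) x y - bondGen c v η x y := by
  classical
  have hjump : ∀ k, k ≤ η x →
      -m ≤ v (jump (η + Finsupp.single z 1) x y k) - v (jump η x y k) := fun k hk => by
    rw [jump_add_single hk]
    exact hm _ _ (degree_jump hk y)
  unfold bondGen pileRate
  by_cases hxz : z = x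
  · subst hxz
    rw [Finsupp.add_apply, Finsupp.single_eq_same]
    have h1 := coupled_sum_ge (c := c (η z)) (c' := c (η z + 1))
      (V := fun k => v (jump η z y k)) (Z := fun k => v (jump (η + Finsupp.single z 1) z y k))
      (α := η z) (m := m) (fun k hk hkα => (hT _ k hk hkα).1) (fun k hk => hT.tail_le hc hk)
      hjump fun k hk => by
        rw [jump_succ_add_single]
        exact hm _ _ (degree_jump hk y)
    simpa only [jump_zero] using h1
  · rw [Finsupp.add_apply, Finsupp.single_eq_of_ne (Ne.symm hxz), add_zero, Finset.sum_mul,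
      ← Finset.sum_neg_distrib, ← Finset.sum_sub_distrib]
    refine Finset.sum_le_sum fun k hk => ?_
    rw [← mul_sub, ← mul_neg]
    exact mul_le_mul_of_nonneg_left (by linarith [hjump k (Finset.mem_Icc.1 hk).2]) (hc _ _)

include hp hc in
/-- The generator of the coupling of two configurations which differ by one particle. -/
theorem finGen_add_single_ge (hT : TailCond c) {v : (X →₀ ℕ) → ℝ} {η : X →₀ ℕ} {m M : ℝ}
    (hM : ∀ ξ, |v ξ| ≤ M)
    (hm : ∀ ξ z, ξ.degree = η.degree → -m ≤ v (ξ + Finsupp.single z 1) - v ξ) (z : X) :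
    -(totalRate c (η + Finsupp.single z 1) * (m + (v (η + Finsupp.single z 1) - v η))) ≤
      finGen p c v (η + Finsupp.single z 1) - finGen p c v η := by
  have hsub : η.support ⊆ (η + Finsupp.single z 1).support := Finsupp.support_mono le_self_add
  rw [finGen_eq_sum hsub, finGen, totalRate, ← Finset.sum_sub_distrib, Finset.sum_mul,
    ← Finset.sum_neg_distrib]
  refine Finset.sum_le_sum fun x _ => ?_
  have h1 := summable_bondGen hp hc (η := η + Finsupp.single z 1) (fun ξ _ => hM ξ) x
  have h2 := summable_bondGen hp hc (η := η) (fun ξ _ => hM ξ) x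
  have h3 := h1.sub h2
  rw [siteGen, siteGen, ← h1.tsum_sub h2]
  simp only [← mul_sub] at h3 ⊢
  exact le_tsum_mul hp h3 fun y => bondGen_add_single_ge hc hT hm x y z

end Finite

end MassMigration

end

noncomputable section

namespace MassMigration

/-! ### The semigroup on configurations with finitely many particles -/

section Semigroup

variable {X : Type*} {a : X → ℝ≥0} {p : X → X → ℝ} {c : ℕ → ℕ → ℝ}
  {P : ℝ≥0 → Kernel (Config a) (Config a)}

theorem abs_semigroup_le (hP : ∀ t, IsMarkovKernel (P t)) {f : Config a → ℝ} {M : ℝ}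
    (hf : ∀ η, |f η| ≤ M) (t : ℝ≥0) (η : Config a) : |semigroup P t f η| ≤ M := by
  have := hP t
  have h1 := norm_integral_le_of_norm_le_const (μ := P t η) (f := f) (C := M)
    (Filter.Eventually.of_forall hf)
  simpa [semigroup, Real.norm_eq_abs] using h1

/-- A bound for the total jump rate of configurations of `N` particles. -/
def levelRate (c : ℕ → ℕ → ℝ) (N : ℕ) : ℝ := N * ∑ n ∈ Finset.range (N + 1), pileRate c n

/-- The time-dependent function `S(s) f` on configurations with finitely many particles. -/
def finSemigroup (P : ℝ≥0 → Kernel (Config a) (Config a)) (f : Config a → ℝ) (s : ℝ)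
    (ξ : X →₀ ℕ) : ℝ :=
  semigroup P s.toNNReal f (toConfig a ξ)

theorem finSemigroup_eq (hP : IsMassMigrationProcess p (fun α _ k => c α k) P) {f : Config a → ℝ}
    (hb : IsBdd f) (hL : ∃ K : ℝ≥0, LipschitzWith K f) (ξ : X →₀ ℕ) {t : ℝ} (ht : 0 ≤ t) :
    IntervalIntegrable (fun s => finGen p c (finSemigroup P f s) ξ) volume 0 t ∧
      finSemigroup P f t ξ =
        f (toConfig a ξ) + ∫ s in (0 : ℝ)..t, finGen p c (finSemigroup P f s) ξ := by
  have h1 := hP.kolmogorov f hb hL (toConfig a ξ) (toConfig_support_finite a ξ) t.toNNReal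
  simp only [generator_toConfig, Real.coe_toNNReal t ht] at h1
  exact h1

theorem finSemigroup_zero (hP : IsMassMigrationProcess p (fun α _ k => c α k) P)
    {f : Config a → ℝ} (hb : IsBdd f) (hL : ∃ K : ℝ≥0, LipschitzWith K f) (ξ : X →₀ ℕ) :
    finSemigroup P f 0 ξ = f (toConfig a ξ) := by
  simpa using (finSemigroup_eq hP hb hL ξ le_rfl).2

theorem semigroup_le_add_single (hp : IsTransition p) (hc : ∀ α k, 0 ≤ c α k) (hT : TailCond c)
    (hP : IsMassMigrationProcess p (fun α _ k => c α k) P) {f : Config a → ℝ} (hb : IsBdd f)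
    (hL : ∃ K : ℝ≥0, LipschitzWith K f) (hmono : Monotone f) (η : X →₀ ℕ) (z : X) (t : ℝ≥0) :
    semigroup P t f (toConfig a η) ≤ semigroup P t f (toConfig a (η + Finsupp.single z 1)) := by
  obtain ⟨M, hM⟩ := id hb
  have hvM : ∀ s ξ, |finSemigroup P f s ξ| ≤ M := fun s ξ => abs_semigroup_le hP.markov hM _ _
  have hdeg : ∀ (ξ : X →₀ ℕ) (y : X), (ξ + Finsupp.single y 1).degree = ξ.degree + 1 := by simp
  -- The index set, all pairs (ξ, z) with ξ of the degree of η, is preserved by the coupled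
  -- dynamics, and its jump rates are bounded by `levelRate`.
  have h1 := nonneg_of_integral_eq (I := {ξ : X →₀ ℕ // ξ.degree = η.degree} × X)
    (w := fun s i => finSemigroup P f s (i.1.1 + Finsupp.single i.2 1) -
      finSemigroup P f s i.1.1)
    (D := fun s i => finGen p c (finSemigroup P f s) (i.1.1 + Finsupp.single i.2 1) -
      finGen p c (finSemigroup P f s) i.1.1)
    (q := fun i => totalRate c (i.1.1 + Finsupp.single i.2 1))
    (C := levelRate c (η.degree + 1)) (M := 2 * M)
    (fun i => totalRate_nonneg hc _)
    (fun i => by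
      have := totalRate_le hc (i.1.1 + Finsupp.single i.2 1)
      rwa [hdeg, i.1.2] at this)
    (mul_nonneg (Nat.cast_nonneg _) (Finset.sum_nonneg fun _ _ => pileRate_nonneg hc _))
    (fun s i => (abs_sub _ _).trans (by linarith [hvM s i.1.1, hvM s (i.1.1 + .single i.2 1)]))
    (fun i t ht => (finSemigroup_eq hP hb hL _ ht).1.sub (finSemigroup_eq hP hb hL _ ht).1)
    (fun i t ht => by
      rw [intervalIntegral.integral_sub (finSemigroup_eq hP hb hL _ ht).1
        (finSemigroup_eq hP hb hL _ ht).1, (finSemigroup_eq hP hb hL _ ht).2,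
        (finSemigroup_eq hP hb hL i.1.1 ht).2, finSemigroup_zero hP hb hL,
        finSemigroup_zero hP hb hL]
      ring)
    (fun i => by
      rw [finSemigroup_zero hP hb hL, finSemigroup_zero hP hb hL]
      exact sub_nonneg.2 (hmono (toConfig_mono a le_self_add)))
    (fun s m _ hm i => finGen_add_single_ge hp hc hT (hvM s)
      (fun ξ y hξ => hm (⟨ξ, hξ.trans i.1.2⟩, y)) i.2)
    t.2 (⟨η, rfl⟩, z)
  simpa [finSemigroup] using h1

theorem semigroup_toConfig_mono (hp : IsTransition p) (hc : ∀ α k, 0 ≤ c α k) (hT : TailCond c)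
    (hP : IsMassMigrationProcess p (fun α _ k => c α k) P) {f : Config a → ℝ} (hb : IsBdd f)
    (hL : ∃ K : ℝ≥0, LipschitzWith K f) (hmono : Monotone f) (t : ℝ≥0) {η ζ : X →₀ ℕ}
    (hηζ : η ≤ ζ) : semigroup P t f (toConfig a η) ≤ semigroup P t f (toConfig a ζ) := by
  have key : ∀ n, ∀ ξ : X →₀ ℕ, ξ.degree = n → ∀ η,
      semigroup P t f (toConfig a η) ≤ semigroup P t f (toConfig a (η + ξ)) := by
    intro n
    induction n with
    | zero =>
      intro ξ hξ η
      rw [(Finsupp.degree_eq_zero_iff ξ).1 hξ, add_zero]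
    | succ n ih =>
      intro ξ hξ η
      obtain ⟨z, hz⟩ : ∃ z, ξ z ≠ 0 := by
        by_contra! hcon
        have : ξ = 0 := Finsupp.ext hcon
        simp [this] at hξ
      have hξ' := tsub_add_cancel_of_le
        (single_le_of_le (η := ξ) (x := z) (k := 1) (Nat.one_le_iff_ne_zero.2 hz))
      have hd : (ξ - Finsupp.single z 1).degree = n := by
        have := congrArg Finsupp.degree hξ'
        simp only [map_add, Finsupp.degree_single] at this
        omega
      rw [← hξ', ← add_assoc]
      exact (ih _ hd η).trans (semigroup_le_add_single hp hc hT hP hb hL hmono _ z t)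
  rw [← add_tsub_cancel_of_le hηζ]
  exact key _ _ rfl η

theorem abs_finSemigroup_sub_le (hp : IsTransition p) (hc : ∀ α k, 0 ≤ c α k)
    (hP : IsMassMigrationProcess p (fun α _ k => c α k) P) {f : Config a → ℝ} {M : ℝ}
    (hM : ∀ η, |f η| ≤ M) (hL : ∃ K : ℝ≥0, LipschitzWith K f) (ξ : X →₀ ℕ) {t : ℝ}
    (ht : 0 ≤ t) :
    |finSemigroup P f t ξ - f (toConfig a ξ)| ≤ levelRate c ξ.degree * (2 * M) * t := by
  have hM0 : 0 ≤ M := (abs_nonneg _).trans (hM (toConfig a ξ))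
  rw [(finSemigroup_eq hP ⟨M, hM⟩ hL ξ ht).2, add_sub_cancel_left]
  have h1 := intervalIntegral.norm_integral_le_of_norm_le_const (a := 0) (b := t)
    (f := fun s => finGen p c (finSemigroup P f s) ξ) (C := levelRate c ξ.degree * (2 * M))
    fun s _ => (abs_finGen_le hp hc fun ζ _ => abs_semigroup_le hP.markov hM _ _).trans
      (mul_le_mul_of_nonneg_right (totalRate_le hc ξ) (by positivity))
  rwa [sub_zero, abs_of_nonneg ht] at h1

/-- The generator is the derivative of the semigroup at time `0`, with a quadratic error bound. -/
theorem abs_finSemigroup_sub_sub_le (hp : IsTransition p) (hc : ∀ α k, 0 ≤ c α k)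
    (hP : IsMassMigrationProcess p (fun α _ k => c α k) P) {f : Config a → ℝ} {M : ℝ}
    (hM : ∀ η, |f η| ≤ M) (hL : ∃ K : ℝ≥0, LipschitzWith K f) (ξ : X →₀ ℕ) {t : ℝ}
    (ht : 0 ≤ t) :
    |finSemigroup P f t ξ - f (toConfig a ξ) - t * finGen p c (fun ζ => f (toConfig a ζ)) ξ| ≤
      4 * M * levelRate c ξ.degree ^ 2 * t ^ 2 := by
  have hM0 : 0 ≤ M := (abs_nonneg _).trans (hM (toConfig a ξ))
  have hR : 0 ≤ levelRate c ξ.degree := (totalRate_nonneg hc ξ).trans (totalRate_le hc ξ)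
  obtain ⟨hint, heq⟩ := finSemigroup_eq hP ⟨M, hM⟩ hL ξ ht
  have h0 : t * finGen p c (fun ζ => f (toConfig a ζ)) ξ =
      ∫ _ in (0 : ℝ)..t, finGen p c (fun ζ => f (toConfig a ζ)) ξ := by simp
  rw [heq, add_sub_cancel_left, h0, ← intervalIntegral.integral_sub hint (by simp)]
  have h1 := intervalIntegral.norm_integral_le_of_norm_le_const (a := 0) (b := t)
    (f := fun s => finGen p c (finSemigroup P f s) ξ - finGen p c (fun ζ => f (toConfig a ζ)) ξ)
    (C := levelRate c ξ.degree * (2 * (levelRate c ξ.degree * (2 * M) * t)))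
    fun s hs => by
      rw [Set.uIoc_of_le ht] at hs
      rw [← finGen_sub hp hc (u := finSemigroup P f s) (M := M) (N := M)
        (fun ζ _ => abs_semigroup_le hP.markov hM _ _) fun ζ _ => hM _]
      refine (abs_finGen_le hp hc (M := levelRate c ξ.degree * (2 * M) * t) fun ζ hζ => ?_).trans
        (mul_le_mul_of_nonneg_right (totalRate_le hc ξ) (by positivity))
      rw [← hζ] at hR ⊢
      exact (abs_finSemigroup_sub_le hp hc hP hM hL ζ hs.1.le).trans
        (mul_le_mul_of_nonneg_left hs.2 (by positivity))
  rw [sub_zero, abs_of_nonneg ht] at h1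
  exact h1.trans_eq (by ring)

/-- S(t)f(η) ≤ S(t)f(ζ) with equality at t = 0, so the derivatives at 0 are ordered; the quadratic
error bound makes this quantitative. -/
theorem Attractive.finGen_le (hp : IsTransition p) (hc : ∀ α k, 0 ≤ c α k)
    (hP : IsMassMigrationProcess p (fun α _ k => c α k) P) (hA : Attractive P)
    {f : Config a → ℝ} (hb : IsBdd f) (hL : ∃ K : ℝ≥0, LipschitzWith K f) (hmono : Monotone f)
    {η ζ : X →₀ ℕ} (hηζ : η ≤ ζ) (hf : f (toConfig a η) = f (toConfig a ζ)) :
    finGen p c (fun ξ => f (toConfig a ξ)) η ≤ finGen p c (fun ξ => f (toConfig a ξ)) ζ := by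
  obtain ⟨M, hM⟩ := id hb
  have hM0 : 0 ≤ M := (abs_nonneg _).trans (hM (toConfig a η))
  set K := 4 * M * levelRate c η.degree ^ 2 + 4 * M * levelRate c ζ.degree ^ 2 with hK
  have hK0 : 0 ≤ K := by positivity
  refine le_of_forall_pos_le_add fun ε hε => ?_
  have ht : 0 < ε / (K + 1) := by positivity
  set t := ε / (K + 1) with htdef
  have h1 := (abs_le.1 (abs_finSemigroup_sub_sub_le hp hc hP hM hL η ht.le)).1
  have h2 := (abs_le.1 (abs_finSemigroup_sub_sub_le hp hc hP hM hL ζ ht.le)).2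
  have h3 : finSemigroup P f t η ≤ finSemigroup P f t ζ :=
    (hA f hb hmono hL.choose_spec.continuous _ (Real.toNNReal_pos.2 ht)).2.1
      (toConfig_mono a hηζ)
  have h4 : K * t ≤ ε := by
    rw [htdef, ← mul_div_assoc, div_le_iff₀ (by positivity)]
    nlinarith
  have h5 : t * finGen p c (fun ξ => f (toConfig a ξ)) η ≤
      t * (finGen p c (fun ξ => f (toConfig a ξ)) ζ + K * t) := by
    rw [hK]
    linarith
  exact (le_of_mul_le_mul_left h5 ht).trans (by linarith)

end Semigroup

/-! ### Functions of finitely many coordinates -/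

section Local

variable {X : Type*} {a : X → ℝ≥0}

theorem Config.mul_le_dist (η ζ : Config a) (x : X) :
    |(η x : ℝ) - (ζ x : ℝ)| * (a x : ℝ) ≤ dist η ζ :=
  (η.summable_dist ζ).le_tsum x fun y _ => by positivity

/-- Occupation numbers are integers, so configurations that differ on A are at distance at least a x
for some x ∈ A; boundedness then gives the Lipschitz estimate. -/
theorem exists_lipschitzWith_of_local (ha : ∀ x, 0 < a x) {f : Config a → ℝ} (hb : IsBdd f)
    (A : Finset X) (hloc : ∀ η ζ : Config a, (∀ x ∈ A, η x = ζ x) → f η = f ζ) :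
    ∃ K : ℝ≥0, LipschitzWith K f := by
  obtain ⟨M, hM⟩ := hb
  have hM0 : 0 ≤ ∑ x ∈ A, (a x : ℝ)⁻¹ := Finset.sum_nonneg fun x _ => inv_nonneg.2 (a x).2
  refine ⟨(2 * M * ∑ x ∈ A, (a x : ℝ)⁻¹).toNNReal, LipschitzWith.of_dist_le' fun η ζ => ?_⟩
  have hM' : 0 ≤ M := (abs_nonneg _).trans (hM η)
  by_cases h : ∀ x ∈ A, η x = ζ x
  · rw [hloc η ζ h, dist_self]
    positivity
  · push Not at h
    obtain ⟨x, hx, hne⟩ := h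
    have hax : (0 : ℝ) < a x := ha x
    have h1 : (1 : ℝ) ≤ |(η x : ℝ) - (ζ x : ℝ)| := by
      have : (1 : ℤ) ≤ |(η x : ℤ) - (ζ x : ℤ)| :=
        Int.one_le_abs (sub_ne_zero.2 (by exact_mod_cast hne))
      exact_mod_cast this
    have h2 : (a x : ℝ) ≤ dist η ζ :=
      (le_mul_of_one_le_left hax.le h1).trans (η.mul_le_dist ζ x)
    have h3 : (a x : ℝ)⁻¹ ≤ ∑ x ∈ A, (a x : ℝ)⁻¹ :=
      Finset.single_le_sum (f := fun x => (a x : ℝ)⁻¹) (fun x _ => inv_nonneg.2 (a x).2) hx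
    have h4 : 1 ≤ (∑ x ∈ A, (a x : ℝ)⁻¹) * dist η ζ := by
      rw [← inv_mul_cancel₀ hax.ne']
      exact mul_le_mul h3 h2 hax.le hM0
    rw [Real.dist_eq, mul_assoc]
    refine (abs_sub _ _).trans ?_
    calc |f η| + |f ζ| ≤ 2 * M * 1 := by linarith [hM η, hM ζ]
      _ ≤ _ := mul_le_mul_of_nonneg_left h4 (by positivity)

open Classical in
/-- The restriction of a configuration to a finite set of sites. -/
def Config.restrict (η : Config a) (A : Finset X) : X →₀ ℕ :=
  Finsupp.onFinset A (fun x => if x ∈ A then η x else 0) fun x hx => by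
    by_contra h
    simp [h] at hx

open Classical in
theorem Config.restrict_apply (η : Config a) (A : Finset X) (x : X) :
    η.restrict A x = if x ∈ A then η x else 0 := rfl

theorem Config.restrict_mono {η ζ : Config a} (h : η ≤ ζ) (A : Finset X) :
    η.restrict A ≤ ζ.restrict A := fun x => by
  rw [Config.restrict_apply, Config.restrict_apply]
  split_ifs
  · exact h x
  · exact le_rfl

theorem Config.tendsto_restrict (η : Config a) :
    Filter.Tendsto (fun A => toConfig a (η.restrict A)) Filter.atTop (nhds η) := by
  classical
  rw [tendsto_iff_dist_tendsto_zero]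
  refine (tendsto_tsum_compl_atTop_zero fun x => (η x : ℝ) * (a x : ℝ)).congr fun A => ?_
  refine (tsum_subtype {x | x ∉ A} fun x => (η x : ℝ) * (a x : ℝ)).trans
    (tsum_congr fun x => ?_)
  rw [toConfig_apply, Config.restrict_apply]
  by_cases hx : x ∈ A <;> simp [hx]

end Local

/-! ### The Feller property and sufficiency of the tail conditions -/

section Attractive

variable {X : Type*} {a : X → ℝ≥0} {p : X → X → ℝ} {c : ℕ → ℕ → ℝ}
  {P : ℝ≥0 → Kernel (Config a) (Config a)}

/-- The Feller property. -/
theorem IsMassMigrationProcess.continuous_semigroup {g : ℕ → ℕ → ℕ → ℝ}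
    (hP : IsMassMigrationProcess p g P) {f : Config a → ℝ} (hb : IsBdd f) (hf : Continuous f)
    (t : ℝ≥0) : Continuous (semigroup P t f) := by
  have := hP.markov t
  have hbdd : ∀ f : Config a → ℝ, (∃ C : ℝ, ∀ x y, dist (f x) (f y) ≤ C) → IsBdd f := by
    rintro f ⟨C, hC⟩
    rcases isEmpty_or_nonempty (Config a) with h | ⟨⟨η₀⟩⟩
    · exact ⟨0, fun e => (h.false e).elim⟩
    · refine ⟨C + |f η₀|, fun e => ?_⟩
      have h1 := hC e η₀
      rw [Real.dist_eq] at h1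
      have h2 := abs_sub_abs_le_abs_sub (f e) (f η₀)
      linarith
  let μ : Config a → ProbabilityMeasure (Config a) := fun η => ⟨P t η, inferInstance⟩
  rw [continuous_iff_continuousAt]
  intro η
  -- Bounded Lipschitz functions determine weak convergence, hence the hypothesis extends to bounded
  -- continuous functions.
  have h1 : Filter.Tendsto μ (nhds η) (nhds (μ η)) :=
    tendsto_iff_forall_lipschitz_integral_tendsto.2 fun f hfb hfL =>
      (hP.continuous_of_lipschitz t f (hbdd f hfb) hfL).continuousAt
  rw [ProbabilityMeasure.tendsto_iff_forall_integral_tendsto] at h1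
  obtain ⟨M, hM⟩ := hb
  exact h1 (BoundedContinuousFunction.ofNormedAddCommGroup f hf M hM)

/-- Two limits along finite sets A: f is replaced by its composition with restriction to A, which is
local and hence Lipschitz, by dominated convergence; then configurations are replaced by their
restrictions, by the Feller property. Countability of X makes the filter of finite sets countably
generated. -/
theorem attractive_of_tailCond [Countable X] (ha : ∀ x, 0 < a x) (hp : IsTransition p)
    (hc : ∀ α k, 0 ≤ c α k) (hT : TailCond c)
    (hP : IsMassMigrationProcess p (fun α _ k => c α k) P) : Attractive P := by
  intro f hb hmono hf t _
  have hcont := hP.continuous_semigroup hb hf t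
  obtain ⟨M, hM⟩ := id hb
  refine ⟨⟨M, abs_semigroup_le hP.markov hM t⟩, ?_, hcont⟩
  have := hP.markov t
  have hfin : ∀ η ζ : X →₀ ℕ, η ≤ ζ →
      semigroup P t f (toConfig a η) ≤ semigroup P t f (toConfig a ζ) := by
    intro η ζ hηζ
    have hLip : ∀ A : Finset X,
        ∃ K : ℝ≥0, LipschitzWith K (fun ξ : Config a => f (toConfig a (ξ.restrict A))) := by
      intro A
      refine exists_lipschitzWith_of_local ha ⟨M, fun ξ => hM _⟩ A fun ξ ξ' h => ?_
      have : ξ.restrict A = ξ'.restrict A := Finsupp.ext fun x => by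
        rw [Config.restrict_apply, Config.restrict_apply]
        split_ifs with hx
        · exact h x hx
        · rfl
      simp only [this]
    have hlim : ∀ ξ, Filter.Tendsto
        (fun A => semigroup P t (fun ξ => f (toConfig a (ξ.restrict A))) ξ) Filter.atTop
        (nhds (semigroup P t f ξ)) := fun ξ =>
      tendsto_integral_filter_of_dominated_convergence (fun _ => M)
        (Filter.Eventually.of_forall fun A =>
          (hLip A).choose_spec.continuous.measurable.aestronglyMeasurable)
        (Filter.Eventually.of_forall fun A => Filter.Eventually.of_forall fun ξ => hM _)
        (integrable_const M)
        (Filter.Eventually.of_forall fun ξ => (hf.tendsto ξ).comp ξ.tendsto_restrict)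
    exact le_of_tendsto_of_tendsto' (hlim _) (hlim _) fun A =>
      semigroup_toConfig_mono hp hc hT hP ⟨M, fun ξ => hM _⟩ (hLip A)
        (fun ξ ξ' h => hmono (toConfig_mono a (Config.restrict_mono h A))) t hηζ
  intro η ζ hηζ
  exact le_of_tendsto_of_tendsto' ((hcont.tendsto η).comp η.tendsto_restrict)
    ((hcont.tendsto ζ).comp ζ.tendsto_restrict) fun A => hfin _ _ (Config.restrict_mono hηζ A)

end Attractive

end MassMigration

end

noncomputable section

namespace MassMigration

/-! ### Necessity of the tail conditions -/

section Necessity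

variable {X : Type*} {a : X → ℝ≥0} {p : X → X → ℝ} {c : ℕ → ℕ → ℝ}
  {P : ℝ≥0 → Kernel (Config a) (Config a)}

theorem IsIrreducibleTransition.exists_pos [Nontrivial X] (h : IsIrreducibleTransition p) :
    ∃ x y, x ≠ y ∧ 0 < p x y := by
  by_contra! hcon
  obtain ⟨x, y, hxy⟩ := exists_pair_ne X
  have key : ∀ z, Relation.ReflTransGen (fun u v => 0 < p u v) x z → x = z := by
    intro z hz
    induction hz with
    | refl => rfl
    | tail _ h2 ih =>
      subst ih
      by_contra hne
      exact absurd h2 (not_lt.2 (hcon _ _ hne))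
  exact hxy (key y (h x y))

/-- The indicator function of `n ≤ η(x)`. -/
def atLeast (a : X → ℝ≥0) (x : X) (n : ℕ) (η : Config a) : ℝ := if n ≤ η x then 1 else 0

theorem isBdd_atLeast (x : X) (n : ℕ) : IsBdd (atLeast a x n) :=
  ⟨1, fun η => by unfold atLeast; split_ifs <;> simp⟩

theorem atLeast_mono (x : X) (n : ℕ) : Monotone (atLeast a x n) := fun η ζ h => by
  have hx : η x ≤ ζ x := h x
  unfold atLeast
  split_ifs with h1 h2 h2
  · exact le_rfl
  · exact absurd (h1.trans hx) h2
  · exact zero_le_one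
  · exact le_rfl

theorem atLeast_lipschitz (ha : ∀ x, 0 < a x) (x : X) (n : ℕ) :
    ∃ K : ℝ≥0, LipschitzWith K (atLeast a x n) :=
  exists_lipschitzWith_of_local ha (isBdd_atLeast x n) {x} fun η ζ h => by
    rw [atLeast, atLeast, h x (Finset.mem_singleton_self x)]

theorem finGen_single (v : (X →₀ ℕ) → ℝ) (x : X) (n : ℕ) :
    finGen p c v (Finsupp.single x n) = ∑' y, p x y *
      ∑ l ∈ Finset.Icc 1 n, c n l * (v (jump (.single x n) x y l) - v (.single x n)) := by
  classical
  rw [finGen_eq_sum Finsupp.support_single_subset, Finset.sum_singleton, siteGen]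
  simp only [bondGen, Finsupp.single_eq_same]

theorem sum_Icc_ite_le (f : ℕ → ℝ) {k : ℕ} (hk : 1 ≤ k) (n : ℕ) :
    ∑ l ∈ Finset.Icc 1 n, f l * (if k ≤ l then 1 else 0) = ∑ l ∈ Finset.Icc k n, f l := by
  simp only [mul_ite, mul_one, mul_zero]
  rw [← Finset.sum_filter]
  refine Finset.sum_congr ?_ fun _ _ => rfl
  ext l
  simp only [Finset.mem_filter, Finset.mem_Icc]
  omega

theorem jump_single_apply_target {x y : X} (hxy : x ≠ y) (z : X) (n l : ℕ) [Decidable (z = y)] :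
    jump (.single x n) x z l y = if z = y then l else 0 := by
  rw [jump, Finsupp.add_apply, Finsupp.tsub_apply, Finsupp.single_eq_of_ne hxy.symm,
    Finsupp.single_eq_of_ne hxy.symm, Nat.sub_zero, Nat.zero_add]
  split_ifs with h
  · rw [h, Finsupp.single_eq_same]
  · rw [Finsupp.single_eq_of_ne (Ne.symm h)]

theorem jump_single_apply_source (x z : X) {n l : ℕ} (hl : l ≤ n) [Decidable (z = x)] :
    jump (.single x n) x z l x = if z = x then n else n - l := by
  rw [jump, Finsupp.add_apply, Finsupp.tsub_apply, Finsupp.single_eq_same, Finsupp.single_eq_same]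
  split_ifs with h
  · rw [h, Finsupp.single_eq_same, Nat.sub_add_cancel hl]
  · rw [Finsupp.single_eq_of_ne (Ne.symm h), add_zero]

/-- From a pile at x, only a jump to y of at least k particles changes the indicator. -/
theorem finGen_atLeast_target {x y : X} (hxy : x ≠ y) {k : ℕ} (hk : 1 ≤ k) (n : ℕ) :
    finGen p c (fun ξ => atLeast a y k (toConfig a ξ)) (.single x n) =
      p x y * ∑ l ∈ Finset.Icc k n, c n l := by
  classical
  have h0 : atLeast a y k (toConfig a (.single x n)) = 0 := by
    rw [atLeast, toConfig_apply, Finsupp.single_eq_of_ne hxy.symm, if_neg (by omega)]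
  rw [finGen_single, tsum_eq_single y]
  · rw [← sum_Icc_ite_le _ hk]
    congr 1
    refine Finset.sum_congr rfl fun l _ => ?_
    rw [h0, sub_zero, atLeast, toConfig_apply, jump_single_apply_target hxy, if_pos rfl]
  · intro z hz
    rw [Finset.sum_eq_zero fun l _ => ?_, mul_zero]
    rw [h0, sub_zero, atLeast, toConfig_apply, jump_single_apply_target hxy, if_neg hz,
      if_neg (by omega), mul_zero]

open Classical in
-- The indicator drops exactly when more than k particles leave x, whatever the target z ≠ x.
theorem finGen_atLeast_source (x : X) {k n : ℕ} (hk : k < n) :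
    finGen p c (fun ξ => atLeast a x (n - k) (toConfig a ξ)) (.single x n) =
      -((∑' y, if y = x then 0 else p x y) * ∑ l ∈ Finset.Icc (k + 1) n, c n l) := by
  have h0 : atLeast a x (n - k) (toConfig a (.single x n)) = 1 := by
    rw [atLeast, toConfig_apply, Finsupp.single_eq_same, if_pos (Nat.sub_le _ _)]
  rw [finGen_single, ← mul_neg, ← tsum_mul_right]
  refine tsum_congr fun z => ?_
  have h1 : ∀ l ∈ Finset.Icc 1 n, c n l * (atLeast a x (n - k)
      (toConfig a (jump (.single x n) x z l)) - atLeast a x (n - k) (toConfig a (.single x n))) =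
      if z = x then 0 else -(c n l * if k + 1 ≤ l then 1 else 0) := by
    intro l hl
    rw [Finset.mem_Icc] at hl
    rw [h0, atLeast, toConfig_apply, jump_single_apply_source x z hl.2]
    by_cases hz : z = x
    · rw [if_pos hz, if_pos hz, if_pos (Nat.sub_le _ _), sub_self, mul_zero]
    · rw [if_neg hz, if_neg hz]
      by_cases hl' : k + 1 ≤ l
      · rw [if_neg (by omega), if_pos hl']; ring
      · rw [if_pos (by omega), if_neg hl']; ring
  rw [Finset.sum_congr rfl h1]
  by_cases hz : z = x
  · simp [hz]
  · simp only [if_neg hz]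
    rw [Finset.sum_neg_distrib, sum_Icc_ite_le _ (by omega)]

theorem tailCond_of_attractive [Nontrivial X] (ha : ∀ x, 0 < a x) (hp : IsTransition p)
    (hirr : IsIrreducibleTransition p) (hc : ∀ α k, 0 ≤ c α k)
    (hP : IsMassMigrationProcess p (fun α _ k => c α k) P) (hA : Attractive P) : TailCond c := by
  classical
  obtain ⟨x, y, hxy, hpos⟩ := hirr.exists_pos
  intro α k hk hkα
  have hle : Finsupp.single x α ≤ Finsupp.single x (α + 1) := Finsupp.single_mono (Nat.le_succ α)
  constructor
  · have h1 := hA.finGen_le hp hc hP (isBdd_atLeast x (α + 1 - k)) (atLeast_lipschitz ha x _)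
      (atLeast_mono x _) hle (by
        rw [atLeast, atLeast, toConfig_apply, toConfig_apply, Finsupp.single_eq_same,
          Finsupp.single_eq_same, if_pos (by omega), if_pos (by omega)])
    rw [finGen_atLeast_source x (show k < α + 1 by omega),
      -- The same threshold means more than k departures from α + 1 particles, but more than k - 1
      -- from α.
      show α + 1 - k = α - (k - 1) by omega,
      finGen_atLeast_source x (show k - 1 < α by omega), Nat.sub_add_cancel hk,
      neg_le_neg_iff] at h1
    have hs : Summable fun z => if z = x then 0 else p x z :=
      Summable.of_nonneg_of_le (fun z => by split_ifs <;> simp [hp.1])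
        (fun z => by split_ifs <;> simp [hp.1]) (hp.2 x).summable
    have hκ : 0 < ∑' z, if z = x then 0 else p x z :=
      hs.tsum_pos (fun z => by split_ifs <;> simp [hp.1]) y (by rwa [if_neg hxy.symm])
    exact le_of_mul_le_mul_left h1 hκ
  · have h1 := hA.finGen_le hp hc hP (isBdd_atLeast y k) (atLeast_lipschitz ha y _)
      (atLeast_mono y _) hle (by
        rw [atLeast, atLeast, toConfig_apply, toConfig_apply, Finsupp.single_eq_of_ne hxy.symm,
          Finsupp.single_eq_of_ne hxy.symm])
    rw [finGen_atLeast_target hxy hk, finGen_atLeast_target hxy hk] at h1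
    exact le_of_mul_le_mul_left h1 hpos

theorem attractive_iff_attractCond [Countable X] [Nontrivial X] (ha : ∀ x, 0 < a x)
    (hp : IsTransition p) (hirr : IsIrreducibleTransition p) {π h : ℕ → ℝ} (hπ : ∀ n, 0 < π n)
    (hh : ∀ k, 1 ≤ k → 0 ≤ h k) (hP : IsMMZRP p π h P) : Attractive P ↔ AttractCond π h := by
  -- The rates do not depend on the occupation of the target, so 0 may stand in for it.
  have hP' : IsMassMigrationProcess p (fun α _ k => zrpRate π h α 0 k) P := hP
  have hc : ∀ α k, 0 ≤ zrpRate π h α 0 k := fun α k => zrpRate_nonneg hπ hh α 0 k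
  rw [attractCond_iff_tailCond]
  exact ⟨tailCond_of_attractive ha hp hirr hc hP', fun hT => attractive_of_tailCond ha hp hc hT hP'⟩

end Necessity

end MassMigration

end

theorem lemma4p5 {X : Type*} [Countable X] [Nontrivial X]
    (p : X → X → ℝ) (hp : MassMigration.IsTransition p)
    (hirr : MassMigration.IsIrreducibleTransition p)
    (a : X → ℝ≥0) (ha : ∀ x, 0 < a x)
    (π h : ℕ → ℝ) (hπ : ∀ n, 0 < π n) (hh : ∀ k, 1 ≤ k → 0 ≤ h k) :
    -- attractiveness in terms of the rates
    (∀ P : ℝ≥0 → Kernel (MassMigration.Config a) (MassMigration.Config a),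
      MassMigration.IsMMZRP p π h P →
        (MassMigration.Attractive P ↔ MassMigration.AttractCond π h)) ∧
    -- `r` nonincreasing
    (AntitoneOn (MassMigration.ratio π) (Set.Ici 1) →
      (MassMigration.AttractCond π h ↔
        (MassMigration.AtOne π h ∧ MassMigration.AtTwo π h)) ∧
      (∀ P : ℝ≥0 → Kernel (MassMigration.Config a) (MassMigration.Config a),
        MassMigration.IsMMZRP p π h P →
          (MassMigration.Attractive P ↔
            (MassMigration.AtOne π h ∧ MassMigration.AtTwo π h)) ∧
          ((∃ k, 1 ≤ k ∧ h k ≠ 0) → MassMigration.Attractive P → MassMigration.AtThree π) ∧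
          (∀ h₀ : ℝ, 0 < h₀ → (∀ k, 1 ≤ k → h k = h₀ * π k) →
            (MassMigration.Attractive P ↔ MassMigration.AtThree π) ∧
            (MassMigration.Attractive P ↔
              ∀ α : ℕ, 2 ≤ α → 0 ≤ MassMigration.critF (MassMigration.ratio π) α))) ∧
      ((∃ k, 1 ≤ k ∧ h k ≠ 0) →
        ∀ P Q : ℝ≥0 → Kernel (MassMigration.Config a) (MassMigration.Config a),
          MassMigration.IsMMZRP p π π P → MassMigration.IsMMZRP p π h Q →
            ¬ MassMigration.Attractive P → ¬ MassMigration.Attractive Q)) ∧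
    -- `r` nondecreasing
    (MonotoneOn (MassMigration.ratio π) (Set.Ici 1) →
      ∀ P : ℝ≥0 → Kernel (MassMigration.Config a) (MassMigration.Config a),
        MassMigration.IsMMZRP p π h P →
          (MassMigration.Attractive P → MassMigration.AtOne π h) ∧
          (MassMigration.ratio π 0 ≤ MassMigration.ratio π 1 →
            MassMigration.AtBis π h → MassMigration.Attractive P)) := by
  have hcond : ∀ P : ℝ≥0 → Kernel (MassMigration.Config a) (MassMigration.Config a),
      MassMigration.IsMMZRP p π h P →
        (MassMigration.Attractive P ↔ MassMigration.AttractCond π h) := fun P hP =>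
    MassMigration.attractive_iff_attractCond ha hp hirr hπ hh hP
  refine ⟨hcond, fun hr => ?_, fun hr P hP => ?_⟩
  · have hat := MassMigration.attractCond_iff_of_antitoneOn hπ hh hr
    have hthree : ∀ P : ℝ≥0 → Kernel (MassMigration.Config a) (MassMigration.Config a),
        MassMigration.IsMMZRP p π h P → (∃ k, 1 ≤ k ∧ h k ≠ 0) →
          MassMigration.Attractive P → MassMigration.AtThree π := fun P hP hne hA =>
      have H := hat.1 ((hcond P hP).1 hA)
      MassMigration.atThree_of_atOne_of_atTwo hπ hh hr hne H.1 H.2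
    refine ⟨hat, fun P hP => ⟨(hcond P hP).trans hat, hthree P hP, fun h₀ h₀pos hh₀ => ?_⟩,
      fun hne P Q hP hQ hPA hQA => hPA ?_⟩
    · have h1 := ((hcond P hP).trans hat).trans
        (MassMigration.atOne_and_atTwo_iff_atThree hπ h₀pos hh₀)
      exact ⟨h1, h1.trans (MassMigration.atThree_iff_critF hπ)⟩
    · have hπ0 : ∀ k, 1 ≤ k → 0 ≤ π k := fun k _ => (hπ k).le
      -- The process with h = π is the case `h₀ = 1`, where (at-3) is sufficient; attractiveness of
      -- `Q` supplies (at-3).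
      rw [MassMigration.attractive_iff_attractCond ha hp hirr hπ hπ0 hP,
        MassMigration.attractCond_iff_of_antitoneOn hπ hπ0 hr,
        MassMigration.atOne_and_atTwo_iff_atThree hπ one_pos fun k _ => (one_mul _).symm]
      exact hthree Q hQ hne hQA
  · rw [hcond P hP]
    exact ⟨fun H => H.atOne hπ, fun hr0 H => H.attractCond hπ hh hr hr0⟩
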